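/- **Theorem 2.5.** Let $K$ be a field of characteristic zero and let $H=(u(x,y,z),\,v(x,y,z),\,h(x,y))$ be a polynomial map $K^3\to K^3$, with $u,v\in K[x,y,z]$, $h\in K[x,y]$ and $\deg_z v\le 1$. Assume that $H(0)=0$, that $u,v,h$ are linearly independent over $K$, and that the Jacobian matrix $JH$ is nilpotent. Then there exist $T\in \operatorname{GL}_3(K)$ and a nonzero polynomial $g\in K[t]$ with $g(0)=0$ such that $$T^{-1}\circ H\circ T=\bigl(z-2y\,g(x+y^2),\; g(x+y^2),\; g(x+y^2)^2\bigr).$$ -/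

import Mathlib

open MvPolynomial

/-- A polynomial map `K^n → K^n`, given by its tuple of components in `K[x_1, …, x_n]`. -/
abbrev PolyMap (n : ℕ) (K : Type*) [CommSemiring K] : Type _ :=
  Fin n → MvPolynomial (Fin n) K

/-- The Jacobian matrix `JH = (∂H_i/∂x_j)`. -/
noncomputable def PolyMap.jacobian {n : ℕ} {K : Type*} [CommSemiring K] (H : PolyMap n K) :
    Matrix (Fin n) (Fin n) (MvPolynomial (Fin n) K) :=
  Matrix.of fun i j => pderiv j (H i)

/-- The linear polynomial map `x ↦ T x` of a square matrix `T`. -/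
noncomputable def PolyMap.ofMatrix {n : ℕ} {K : Type*} [CommSemiring K]
    (T : Matrix (Fin n) (Fin n) K) : PolyMap n K :=
  fun i => ∑ j, C (T i j) * X j

/-- The composition `F ∘ G` of polynomial maps: substitute the components of `G` for the
variables of `F`. -/
noncomputable def PolyMap.comp {n : ℕ} {K : Type*} [CommSemiring K] (F G : PolyMap n K) :
    PolyMap n K :=
  fun i => bind₁ G (F i)

/-- The linear conjugate `T⁻¹ ∘ H ∘ T` of `H` by an invertible matrix `T`. -/
noncomputable def PolyMap.conj {n : ℕ} {K : Type*} [CommRing K]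
    (T : Matrix.GeneralLinearGroup (Fin n) K) (H : PolyMap n K) : PolyMap n K :=
  PolyMap.comp (PolyMap.ofMatrix (T⁻¹ : Matrix.GeneralLinearGroup (Fin n) K).val)
    (PolyMap.comp H (PolyMap.ofMatrix T.val))

/-- The polynomial map `(z - 2 y g(x + y²), g(x + y²), g(x + y²)²)` in the variables
`x = X 0`, `y = X 1`, `z = X 2`, for a one-variable polynomial `g`. -/
noncomputable def PolyMap.standardForm {K : Type*} [CommRing K] (g : Polynomial K) :
    PolyMap 3 K :=
  ![X 2 - 2 * X 1 * Polynomial.aeval (X 0 + X 1 ^ 2 : MvPolynomial (Fin 3) K) g,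
    Polynomial.aeval (X 0 + X 1 ^ 2 : MvPolynomial (Fin 3) K) g,
    Polynomial.aeval (X 0 + X 1 ^ 2 : MvPolynomial (Fin 3) K) g ^ 2]

/-! Write partial derivatives as subscripts. Nilpotency of `JH` makes the trace, the sum of
principal 2-minors and the determinant vanish. As `h` is free of z and `v` has degree at most 1 in
z, repeated z-derivatives of these three equations are short.

They first bound the z-degree of `u` by 1. If it were n ≥ 2, the leading coefficient a would be free
of x. For nonconstant a they give n a v_zy = a_y v_z together with a divisibility by a that degrees
forbid (`dy_leading_eq_zero`); constant a is excluded by independence (`leading_not_constant`).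

Next, (u_z, v_z) is a planar map with nilpotent Jacobian, so its components are linearly related
modulo constants (`exists_linear_relation_of_nilpotent_plane`). With this, u_z and v_z are
constants, not both zero (`exists_dz_constant`), and a linear change gives u_z = 1, v_z = 0.

What remains is differential geometry of the level curves of `v`. The derivation D = ∂_y - (v_y/v_x)
∂_x is differentiation along them. The equations make the slope v_y/v_x a polynomial of degree at
most 1 in y along each curve, so the curves are parabolas or lines. Since `v` is a polynomial, the
leading coefficient of such a parametrization is algebraic over K
(`isAlgebraic_coeff_of_derivation_aeval_eq_zero`), hence in K. Thus all level curves are translates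
of one parabola and `v` is a polynomial in x + (k/2) y² - b y. Integrating the equations then gives
`u` and `h` (`exists_normal_form`); independence forces k ≠ 0, and a linear rescaling reaches the
standard form. -/

/-! ### Derivations on fraction fields and their constants. -/

/-- A derivation of a domain extends to its fraction field. -/
theorem exists_derivation_extension {K R : Type*} [Field K] [CommRing R] [IsDomain R] [Algebra K R]
    (L : Type*) [Field L] [Algebra R L] [IsFractionRing R L] [Algebra K L] [IsScalarTower K R L]
    (d : Derivation K R R) :
    ∃ D : Derivation K L L, ∀ a, D (algebraMap R L a) = algebraMap R L (d a) := by
  -- A localization is formally étale, so Ω[L⁄K] is the base change of Ω[R⁄K], and `d` extends by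
  -- linearity.
  have : Algebra.FormallyEtale R L :=
    Algebra.FormallyEtale.of_isLocalization (nonZeroDivisors R)
  let e := KaehlerDifferential.tensorKaehlerEquivOfFormallyEtale K R L
  let f : Ω[R⁄K] →ₗ[R] L := (Algebra.linearMap R L).comp d.liftKaehlerDifferential
  let g : Ω[L⁄K] →ₗ[L] L := (f.liftBaseChange L).comp e.symm.toLinearMap
  refine ⟨g.compDer (KaehlerDifferential.D K L), fun a => ?_⟩
  have h : e.symm (KaehlerDifferential.D K L (algebraMap R L a)) =
      1 ⊗ₜ KaehlerDifferential.D K R a := by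
    rw [LinearEquiv.symm_apply_eq]
    simp [e]
  simp [g, h, f]

/-- An element of derivative `1` is transcendental over the constants. -/
theorem Polynomial.eq_zero_of_eval_eq_zero_of_derivation {K R : Type*} [CommRing K] [CommRing R]
    [IsDomain R] [CharZero R] [Algebra K R] (D : Derivation K R R) {y : R} (hy : D y = 1)
    (P : Polynomial R) (hP : ∀ i, D (P.coeff i) = 0) (h0 : P.eval y = 0) : P = 0 := by
  have key : ∀ P : Polynomial R, (∀ i, D (P.coeff i) = 0) →
      D (P.eval y) = P.derivative.eval y := by
    intro P hP
    rw [Polynomial.eval_eq_sum_range, Polynomial.derivative_eval, Polynomial.sum_over_range _ (by simp), map_sum]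
    refine Finset.sum_congr rfl fun i _ => ?_
    simp [Derivation.leibniz, Derivation.leibniz_pow, hP, hy, mul_assoc]
  -- Applying D to P(y) = 0 gives P'(y) = 0 by `key`; the derivative has smaller degree and again
  -- constant coefficients, so it is zero and P is a constant.
  induction hn : P.natDegree using Nat.strong_induction_on generalizing P with
  | _ n ih =>
    have hd : P.derivative.eval y = 0 := by rw [← key P hP, h0, map_zero]
    have hc : ∀ i, D (P.derivative.coeff i) = 0 := fun i => by
      simp [Polynomial.coeff_derivative, Derivation.leibniz, hP]
    rcases Nat.eq_zero_or_pos n with h | h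
    · rw [Polynomial.eq_C_of_natDegree_eq_zero (hn.trans h)] at h0 ⊢
      simpa using h0
    · have := ih _ (hn ▸ Polynomial.natDegree_derivative_lt (by omega)) _ hc hd rfl
      have := Polynomial.derivative_eq_zero.1 this
      omega

/-- If the value of a nonconstant polynomial `q` along the curve `x = f(y)`, with `f` having
constant coefficients, is constant, then the leading coefficient of `f` is algebraic. -/
theorem isAlgebraic_coeff_of_derivation_aeval_eq_zero {K L : Type*} [Field K] [Field L] [CharZero L]
    [Algebra K L] (D : Derivation K L L) {x y : L} (hy : D y = 1)
    (q : MvPolynomial (Fin 2) K) (hq : D (aeval ![x, y] q) = 0)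
    (hq' : ∀ c, q ≠ C c) (f : Polynomial L) (hf : ∀ i, D (f.coeff i) = 0) (hx : f.eval y = x)
    (n : ℕ) (hn : 1 ≤ n) (hfn : f.natDegree ≤ n) : IsAlgebraic K (f.coeff n) := by
  classical
  let A : Subalgebra K L :=
    { carrier := {a | D a = 0}
      mul_mem' := fun {a b} ha hb => by
        simp only [Set.mem_ofPred_eq] at *; simp [Derivation.leibniz, ha, hb]
      add_mem' := fun {a b} ha hb => by
        simp only [Set.mem_ofPred_eq] at *; simp [ha, hb]
      algebraMap_mem' := fun r => by simp }
  -- The restriction of `q` to the curve x = f(T), y = T. Its coefficients are killed by D, and so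
  -- is its value at `y`; transcendence of `y` over the constants makes P constant.
  let P : Polynomial L := aeval ![f, Polynomial.X] q
  have hPe : P.eval y = aeval ![x, y] q := by
    have : ((Polynomial.aeval y).restrictScalars K).comp (aeval (R := K) ![f, Polynomial.X])
        = aeval ![x, y] := by
      ext i; fin_cases i <;> simp [← hx]
    have := DFunLike.congr_fun this q
    simpa [P, Polynomial.aeval_def, Polynomial.eval₂_eq_eval_map] using this
  have hPc : ∀ i, D (P.coeff i) = 0 := by
    let S : Subalgebra K (Polynomial L) :=
      { carrier := {p | ∀ i, p.coeff i ∈ A}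
        mul_mem' := fun {a b} ha hb i => by
          rw [Polynomial.coeff_mul]
          exact A.sum_mem fun j _ => A.mul_mem (ha _) (hb _)
        add_mem' := fun {a b} ha hb i => by
          rw [Polynomial.coeff_add]; exact A.add_mem (ha i) (hb i)
        algebraMap_mem' := fun r i => by
          rw [Polynomial.algebraMap_apply, Polynomial.coeff_C]
          split_ifs
          · exact A.algebraMap_mem r
          · exact A.zero_mem }
    have hfS : f ∈ S := hf
    have hXS : (Polynomial.X : Polynomial L) ∈ S := fun i => by
      rw [Polynomial.coeff_X]; split_ifs
      · exact A.one_mem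
      · exact A.zero_mem
    have : P ∈ S := by
      have h1 : P ∈ (aeval (R := K) ![f, Polynomial.X]).range := ⟨q, rfl⟩
      rw [← Algebra.adjoin_range_eq_range_aeval] at h1
      refine Algebra.adjoin_le ?_ h1
      rintro _ ⟨i, rfl⟩
      fin_cases i
      · exact hfS
      · exact hXS
    exact this
  have hP : P = Polynomial.C (P.eval y) := by
    rw [← sub_eq_zero]
    refine Polynomial.eq_zero_of_eval_eq_zero_of_derivation D hy _ (fun i => ?_) (by simp)
    rw [Polynomial.coeff_sub, map_sub, hPc, Polynomial.coeff_C]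
    split_ifs
    · rw [hPe, hq, sub_zero]
    · simp
  -- the weighted degree
  have hne : q.support.Nonempty := by
    rw [Finset.nonempty_iff_ne_empty, Ne, MvPolynomial.support_eq_empty]
    rintro rfl; exact hq' 0 (by simp)
  let w : (Fin 2 →₀ ℕ) → ℕ := fun m => n * m 0 + m 1
  obtain ⟨m₀, hm₀, hmax⟩ := q.support.exists_max_image w hne
  have hw : 1 ≤ w m₀ := by
    by_contra hlt
    refine hq' (coeff 0 q) ?_
    have : ∀ m ∈ q.support, m = 0 := fun m hm => by
      have := hmax m hm
      have h0 : n * m 0 + m 1 = 0 := by simp only [w] at *; omega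
      ext i; fin_cases i
      · have := (Nat.add_eq_zero_iff.1 h0).1
        rcases Nat.mul_eq_zero.1 this with h | h
        · omega
        · simpa using h
      · simpa using (Nat.add_eq_zero_iff.1 h0).2
    ext m
    rw [coeff_C]
    split_ifs with h
    · rw [h]
    · by_contra hc
      exact h (this m (mem_support_iff.2 hc)).symm
  have hcoeff : P.coeff (w m₀) = ∑ m ∈ q.support,
      if w m = w m₀ then algebraMap K L (coeff m q) * f.coeff n ^ m 0 else 0 := by
    have hPs : P = ∑ m ∈ q.support, Polynomial.C (algebraMap K L (coeff m q)) *
        (f ^ m 0 * Polynomial.X ^ m 1) := by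
      simp only [P, aeval_def, eval₂_eq', Fin.prod_univ_two]
      rfl
    rw [hPs, Polynomial.finsetSum_coeff]
    refine Finset.sum_congr rfl fun m hm => ?_
    rw [Polynomial.coeff_C_mul]
    have hdeg : (f ^ m 0).natDegree ≤ m 0 * n := Polynomial.natDegree_pow_le_of_le _ hfn
    split_ifs with h
    · rw [← h, show w m = m 0 * n + m 1 by simp only [w]; ring, Polynomial.coeff_mul_X_pow,
        Polynomial.coeff_pow_of_natDegree_le hfn]
    · rw [Polynomial.coeff_eq_zero_of_natDegree_lt, mul_zero]
      refine lt_of_le_of_lt (Polynomial.natDegree_mul_le_of_le hdeg (Polynomial.natDegree_X_pow_le _)) ?_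
      have := lt_of_le_of_ne (hmax m hm) h
      simp only [w] at *
      nlinarith
  have hz : P.coeff (w m₀) = 0 := by
    rw [hP, Polynomial.coeff_C, if_neg (by omega)]
  -- The part of `q` of top weight (x of weight n, y of weight 1), with y set to 1. Monomials of
  -- equal weight and equal x-exponent coincide, so nothing cancels and Q is nonzero; its value at
  -- `f.coeff n` is the top coefficient of the constant P.
  let Q : Polynomial K := ∑ m ∈ q.support, if w m = w m₀ then
    Polynomial.monomial (m 0) (coeff m q) else 0
  refine ⟨Q, ?_, ?_⟩
  · intro h0
    have : Q.coeff (m₀ 0) = coeff m₀ q := by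
      simp only [Q, Polynomial.finsetSum_coeff]
      rw [Finset.sum_eq_single m₀]
      · simp
      · intro m hm hne
        split_ifs with h
        · rw [Polynomial.coeff_monomial, if_neg]
          intro h'
          apply hne
          simp only [w, h'] at h
          ext i; fin_cases i
          · exact h'
          · simpa using h
        · simp
      · exact fun h => (h hm₀).elim
    rw [h0] at this
    exact mem_support_iff.1 hm₀ (by simpa using this.symm)
  · rw [← hz, hcoeff, map_sum]
    refine Finset.sum_congr rfl fun m _ => ?_
    split_ifs <;> simp [Polynomial.aeval_monomial]

/-- In characteristic zero a derivation kills algebraic elements. -/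
theorem Derivation.eq_zero_of_isAlgebraic {K L : Type*} [Field K] [CharZero K] [Field L] [Algebra K L]
    (D : Derivation K L L) {a : L} (ha : IsAlgebraic K a) : D a = 0 := by
  have hi := ha.isIntegral
  have h1 : D (Polynomial.aeval a (minpoly K a)) = 0 := by simp
  rw [Derivation.map_aeval] at h1
  have h2 : Polynomial.aeval a (Polynomial.derivative (minpoly K a)) ≠ 0 :=
    (minpoly.irreducible hi).separable.aeval_derivative_ne_zero (minpoly.aeval K a)
  simpa [h2] using h1

/-- A derivation of a fraction field vanishing on the domain is zero. -/
theorem Derivation.eq_zero_of_forall_algebraMap {K R L : Type*} [Field K] [CommRing R] [IsDomain R]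
    [Field L] [Algebra R L] [IsFractionRing R L] [Algebra K L] (E : Derivation K L L)
    (h : ∀ a : R, E (algebraMap R L a) = 0) (f : L) : E f = 0 := by
  obtain ⟨a, b, hb, rfl⟩ := IsFractionRing.div_surjective (A := R) f
  have hb' : algebraMap R L b ≠ 0 :=
    IsFractionRing.to_map_ne_zero_of_mem_nonZeroDivisors hb
  have h1 : E (algebraMap R L a / algebraMap R L b * algebraMap R L b) = 0 := by
    rw [div_mul_cancel₀ _ hb']; exact h a
  rw [Derivation.leibniz, h b] at h1
  simpa [hb'] using h1

/-- If the gradient of f is l times that of g, equality of the mixed derivatives of f and of g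
forces the gradient of l to be parallel to that of g. -/
theorem Derivation.cross_mul_eq_of_smul {K L : Type*} [CommRing K] [CommRing L] [Algebra K L]
    (d₁ d₂ : Derivation K L L) {f g l : L} (hf : d₁ (d₂ f) = d₂ (d₁ f))
    (hg : d₁ (d₂ g) = d₂ (d₁ g)) (h₁ : d₁ f = l * d₁ g) (h₂ : d₂ f = l * d₂ g) :
    d₂ l * d₁ g = d₁ l * d₂ g := by
  have := hf
  rw [h₁, h₂, Derivation.leibniz, Derivation.leibniz, hg] at this
  simp only [smul_eq_mul] at this
  linear_combination -this

/-! ### Level curves in the plane. -/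

section Plane

variable {K R : Type*} [Field K] [CharZero K] [CommRing R] [IsDomain R] [Algebra K R]
  {dx dy dz : Derivation K R R}

/-- An algebraic element is integral over R, hence lies in R, and every derivation kills it in
characteristic zero. -/
theorem exists_algebraMap_eq_of_isAlgebraic [IsIntegrallyClosed R]
    (hc : ∀ f, dx f = 0 → dy f = 0 → dz f = 0 → ∃ c, f = algebraMap K R c)
    {L : Type*} [Field L] [Algebra R L] [IsFractionRing R L] [Algebra K L] [IsScalarTower K R L]
    {a : L} (ha : IsAlgebraic K a) : ∃ c, a = algebraMap K L c := by
  obtain ⟨r, hr⟩ := IsIntegrallyClosed.isIntegral_iff.1 (ha.isIntegral.tower_top (A := R))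
  have h : ∀ d : Derivation K R R, d r = 0 := fun d => by
    obtain ⟨D, hD⟩ := exists_derivation_extension L d
    have := D.eq_zero_of_isAlgebraic ha
    rw [← hr, hD] at this
    exact (map_eq_zero_iff _ (IsFractionRing.injective R L)).1 this
  obtain ⟨c, rfl⟩ := hc r (h _) (h _) (h _)
  exact ⟨c, by rw [← hr, ← IsScalarTower.algebraMap_apply]⟩

omit [CharZero K] [IsDomain R] in
theorem exists_aeval_eq_of_mem_adjoin_pair {x y f : R} (h : f ∈ Algebra.adjoin K {x, y}) :
    ∃ q : MvPolynomial (Fin 2) K, f = aeval ![x, y] q := by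
  have : ({x, y} : Set R) = Set.range ![x, y] := by simp [Set.pair_comm]
  rw [this, Algebra.adjoin_range_eq_range_aeval] at h
  obtain ⟨q, hq⟩ := h
  exact ⟨q, hq.symm⟩

/-- A planar polynomial map with nilpotent Jacobian has linearly dependent components
up to constants. -/
theorem exists_linear_relation_of_nilpotent_plane [IsIntegrallyClosed R]
    (L : Type*) [Field L] [Algebra R L] [IsFractionRing R L] [Algebra K L] [IsScalarTower K R L]
    (hc : ∀ f, dx f = 0 → dy f = 0 → dz f = 0 → ∃ c, f = algebraMap K R c)
    (hxy : ∀ f, dx (dy f) = dy (dx f)) {x y : R}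
    (hxx : dx x = 1) (hyx : dy x = 0) (hyxy : dx y = 0) (hyy : dy y = 1)
    {p q : R} (hpz : dz p = 0) (hqz : dz q = 0) (hq : q ∈ Algebra.adjoin K {x, y})
    (htr : dx p + dy q = 0) (hdet : dx p * dy q = dy p * dx q) :
    ∃ s r : K, (s ≠ 0 ∨ r ≠ 0) ∧ ∃ c, s • p + r • q = algebraMap K R c := by
  have htr' : dx p = -dy q := by linear_combination htr
  by_cases hqx : dx q = 0
  · have hqy : dy q = 0 := by
      rw [hqx, htr'] at hdet
      have : dy q * dy q = 0 := by linear_combination -hdet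
      simpa using this
    obtain ⟨c, rfl⟩ := hc q hqx hqy hqz
    exact ⟨0, 1, Or.inr one_ne_zero, c, by simp⟩
  have hinj := IsFractionRing.injective R L
  have : CharZero R := charZero_of_injective_algebraMap (FaithfulSMul.algebraMap_injective K R)
  have : CharZero L := charZero_of_injective_algebraMap hinj
  obtain ⟨Dx, hDx⟩ := exists_derivation_extension L dx
  obtain ⟨Dy, hDy⟩ := exists_derivation_extension L dy
  let i := algebraMap R L
  have hqx' : i (dx q) ≠ 0 := by
    rw [Ne, map_eq_zero_iff _ hinj]; exact hqx
  -- The gradient of p is -n times that of q. Mixed derivatives then give n_y = n n_x, so n is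
  -- constant along the level curves of q, which are therefore the lines x + n y = const.
  let n : L := i (dy q) / i (dx q)
  have hn : i (dy q) = n * i (dx q) := by simp only [n]; rw [div_mul_cancel₀ _ hqx']
  have hpx : i (dx p) = -n * i (dx q) := by rw [htr', map_neg, hn]; ring
  have hpy : i (dy p) = -n * i (dy q) := by
    have := congrArg i hdet
    rw [map_mul, map_mul, hpx] at this
    apply mul_right_cancel₀ hqx'
    linear_combination -this
  have hcross : Dy (-n) * i (dx q) = Dx (-n) * i (dy q) := by
    have := Derivation.cross_mul_eq_of_smul Dx Dy (f := i p) (g := i q) (l := -n)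
      (by simp only [i, hDx, hDy, hxy]) (by simp only [i, hDx, hDy, hxy])
      (by simp only [i, hDx] at *; exact hpx) (by simp only [i, hDy] at *; exact hpy)
    simpa only [i, hDx, hDy] using this
  have hDn : Dy n = n * Dx n := by
    apply mul_right_cancel₀ hqx'
    rw [map_neg, map_neg, hn] at hcross
    linear_combination -hcross
  let D : Derivation K L L := Dy - n • Dx
  have hD : ∀ f, D f = Dy f - n * Dx f := fun f => by simp [D]
  obtain ⟨Q, hQ⟩ := exists_aeval_eq_of_mem_adjoin_pair hq
  have hQL : aeval ![i x, i y] Q = i q := by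
    rw [hQ, ← aeval_algebraMap_apply]
    congr 2; ext j; fin_cases j <;> rfl
  -- The line through (x, y), parametrized by its second coordinate.
  have halg : IsAlgebraic K ((Polynomial.C (-n) * Polynomial.X + Polynomial.C (i x + n * i y) :
      Polynomial L).coeff 1) := by
    refine isAlgebraic_coeff_of_derivation_aeval_eq_zero D (x := i x) (y := i y) ?_ Q ?_ ?_ _
      ?_ ?_ 1 le_rfl Polynomial.natDegree_linear_le
    · rw [hD, hDx, hDy, hyy, hyxy]; simp
    · rw [hQL, hD, hDx, hDy]; exact sub_eq_zero.2 hn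
    · rintro c rfl
      apply hqx; rw [hQ]; simp
    · have h1 : D n = 0 := by rw [hD, hDn, sub_self]
      have h2 : D (i x + n * i y) = 0 := by
        simp only [map_add, Derivation.leibniz, hD, hDx, hDy, hyy, hyxy, hxx, hyx, i, map_one,
          map_zero, smul_eq_mul, hDn]
        ring
      rintro (_ | _ | j)
      · simpa using h2
      · simpa using h1
      · simp
    · simp
  obtain ⟨c, hcn⟩ := exists_algebraMap_eq_of_isAlgebraic hc halg
  have hcn' : -n = i (algebraMap K R c) := by
    rw [← IsScalarTower.algebraMap_apply, ← hcn]; simp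
  rw [hcn', ← map_mul] at hpx hpy
  have hpx := hinj hpx
  have hpy := hinj hpy
  refine ⟨1, -c, Or.inl one_ne_zero, hc _ ?_ ?_ ?_⟩
  · simp [hpx, Algebra.smul_def]
  · simp [hpy, Algebra.smul_def]
  · simp [hpz, hqz]

/-- The level curves of `v` are translates of one parabola. -/
theorem exists_level_curve_parabola [IsIntegrallyClosed R]
    (L : Type*) [Field L] [Algebra R L] [IsFractionRing R L] [Algebra K L] [IsScalarTower K R L]
    (hc : ∀ f, dx f = 0 → dy f = 0 → dz f = 0 → ∃ c, f = algebraMap K R c)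
    (hxy : ∀ f, dx (dy f) = dy (dx f)) {x y : R}
    (hxx : dx x = 1) (hyx : dy x = 0) (hyxy : dx y = 0) (hyy : dy y = 1)
    {u v h : R} (hv : v ∈ Algebra.adjoin K {x, y}) (hvx : dx v ≠ 0)
    (htr : dx u + dy v = 0) (hmin : dy v ^ 2 + dy u * dx v + dx h = 0)
    (hdet : dy h * dx v = dx h * dy v) :
    ∃ k b : K, dy v = (k • y - algebraMap K R b) * dx v := by
  have htr' : dx u = -dy v := by linear_combination htr
  have hinj := IsFractionRing.injective R L
  have : CharZero R := charZero_of_injective_algebraMap (FaithfulSMul.algebraMap_injective K R)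
  have : CharZero L := charZero_of_injective_algebraMap hinj
  obtain ⟨Dx, hDx⟩ := exists_derivation_extension L dx
  obtain ⟨Dy, hDy⟩ := exists_derivation_extension L dy
  have hcomm : ∀ f, Dx (Dy f) = Dy (Dx f) := fun f => by
    rw [← sub_eq_zero, ← Derivation.commutator_apply]
    refine Derivation.eq_zero_of_forall_algebraMap (R := R) _ (fun a => ?_) f
    simp only [Derivation.commutator_apply, hDx, hDy, hxy, sub_self]
  let i := algebraMap R L
  have hix : ∀ f, Dx (i f) = i (dx f) := hDx
  have hiy : ∀ f, Dy (i f) = i (dy f) := hDy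
  have hvx' : i (dx v) ≠ 0 := by
    rw [Ne, map_eq_zero_iff _ hinj]; exact hvx
  obtain ⟨m, hm⟩ : ∃ m, i (dy v) = m * i (dx v) := ⟨i (dy v) / i (dx v), by rw [div_mul_cancel₀ _ hvx']⟩
  obtain ⟨l, hl⟩ : ∃ l, i (dx h) = l * i (dx v) := ⟨i (dx h) / i (dx v), by rw [div_mul_cancel₀ _ hvx']⟩
  have hly : i (dy h) = l * i (dy v) := by
    have := congrArg i hdet
    rw [map_mul, map_mul, hl] at this
    apply mul_right_cancel₀ hvx'
    linear_combination this
  -- So far ∇h = l ∇v; the cross relation applied twice yields ∇l = k ∇v and then ∇k parallel to ∇v.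
  -- Thus l and k are constant on the level curves of v.
  obtain ⟨k, hk⟩ : ∃ k, Dx l = k * i (dx v) := ⟨Dx l / i (dx v), by rw [div_mul_cancel₀ _ hvx']⟩
  have hky : Dy l = k * i (dy v) := by
    have := Derivation.cross_mul_eq_of_smul Dx Dy (f := i h) (g := i v) (l := l)
      (hcomm _) (hcomm _) (by rw [hix, hix, hl]) (by rw [hiy, hiy, hly])
    rw [hix, hiy, hk] at this
    apply mul_right_cancel₀ hvx'
    linear_combination this
  have hDk : Dy k = m * Dx k := by
    have := Derivation.cross_mul_eq_of_smul Dx Dy (f := l) (g := i v) (l := k)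
      (hcomm _) (hcomm _) (by rw [hix, hk]) (by rw [hiy, hky])
    rw [hix, hiy, hm] at this
    apply mul_right_cancel₀ hvx'
    linear_combination this
  have hux : Dx (i u) = -(m * i (dx v)) := by rw [hix, htr', map_neg, hm]
  have huy : Dy (i u) = -(l + m ^ 2 * i (dx v)) := by
    have := congrArg i hmin
    simp only [map_add, map_mul, map_pow, map_zero, hl, hm] at this
    rw [hiy]
    apply mul_right_cancel₀ hvx'
    linear_combination this
  -- The equality of the mixed derivatives of u, whose gradient is expressed through m and l. Along
  -- a level curve x then has derivative -m and m has constant derivative k.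
  have hDm : Dy m - m * Dx m = k := by
    have h1 := hcomm (i u)
    rw [hux, huy] at h1
    have h2 := congrArg Dx hm
    simp only [map_neg, map_add, Derivation.leibniz, Derivation.leibniz_pow, smul_eq_mul, hix,
      hiy, hk, hxy, nsmul_eq_mul] at h1 h2
    apply mul_right_cancel₀ hvx'
    have h3 : i (dy (dx v)) = m * i (dx (dx v)) + i (dx v) * Dx m := by
      rw [← h2]
    rw [h3] at h1
    push_cast at h1
    linear_combination h1
  let D : Derivation K L L := Dy - m • Dx
  have hD : ∀ f, D f = Dy f - m * Dx f := fun f => by simp [D]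
  have hDx1 : D (i x) = -m := by rw [hD, hix, hiy, hxx, hyx]; simp
  have hDy1 : D (i y) = 1 := by rw [hD, hix, hiy, hyy, hyxy]; simp
  have hDv : D (i v) = 0 := by rw [hD, hix, hiy, hm, sub_self]
  have hDm1 : D m = k := by rw [hD, hDm]
  have hDk1 : D k = 0 := by rw [hD, hDk, sub_self]
  have hDb : D (k * i y - m) = 0 := by
    simp [Derivation.leibniz, hDk1, hDy1, hDm1]
  obtain ⟨Q, hQ⟩ := exists_aeval_eq_of_mem_adjoin_pair hv
  have hQL : aeval ![i x, i y] Q = i v := by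
    rw [hQ, ← aeval_algebraMap_apply]
    congr 2; ext j; fin_cases j <;> rfl
  have hD2 : D 2 = 0 := mod_cast D.map_natCast 2
  -- The parabola through (x, y), parametrized by its second coordinate; the three coefficients are
  -- killed by D.
  have halg : IsAlgebraic K ((Polynomial.C (-k / 2) * Polynomial.X ^ 2 +
      Polynomial.C (k * i y - m) * Polynomial.X +
      Polynomial.C (i x - k * i y ^ 2 / 2 + m * i y) : Polynomial L).coeff 2) := by
    refine isAlgebraic_coeff_of_derivation_aeval_eq_zero D (x := i x) (y := i y) hDy1 Q ?_ ?_ _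
      ?_ ?_ 2 (by norm_num) Polynomial.natDegree_quadratic_le
    · rw [hQL, hDv]
    · rintro c rfl
      apply hvx; rw [hQ]; simp
    · have h1 : D (-k / 2) = 0 := by
        simp [Derivation.leibniz_div, hDk1, hD2]
      have h2 : D (i x - k * i y ^ 2 / 2 + m * i y) = 0 := by
        simp only [map_add, map_sub, Derivation.leibniz_div, Derivation.leibniz, Derivation.leibniz_pow, hDk1,
          hDx1, hDy1, hDm1, hD2, smul_eq_mul, nsmul_eq_mul]
        field_simp
        push_cast
        ring
      rintro (_ | _ | _ | j)
      · simpa using h2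
      · simpa using hDb
      · simpa using h1
      · simp
    · simp; ring
  obtain ⟨c, hcn⟩ := exists_algebraMap_eq_of_isAlgebraic hc halg
  obtain ⟨k₀, rfl⟩ : ∃ k₀ : K, k = algebraMap K L k₀ := by
    refine ⟨-2 * c, ?_⟩
    rw [map_mul, ← hcn, map_neg, map_ofNat]
    simp [mul_div_cancel₀]
  -- With k in K, the coordinate x + (k/2) y² straightens the parabolas to lines with linear
  -- coefficient k y - m, and the algebraicity argument applies again to that coefficient.
  have hvX : v ∈ Algebra.adjoin K {x + (k₀ / 2) • y ^ 2, y} := by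
    refine Algebra.adjoin_le ?_ hv
    have h1 : x + (k₀ / 2) • y ^ 2 ∈ Algebra.adjoin K {x + (k₀ / 2) • y ^ 2, y} :=
      Algebra.subset_adjoin (by simp)
    have h2 : y ∈ Algebra.adjoin K {x + (k₀ / 2) • y ^ 2, y} :=
      Algebra.subset_adjoin (by simp)
    rintro _ (rfl | rfl)
    · have := Subalgebra.sub_mem _ h1 (Subalgebra.smul_mem _ (Subalgebra.pow_mem _ h2 2) (k₀ / 2))
      simpa using this
    · exact h2
  obtain ⟨Q', hQ'⟩ := exists_aeval_eq_of_mem_adjoin_pair hvX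
  have hQL' : aeval ![i (x + (k₀ / 2) • y ^ 2), i y] Q' = i v := by
    rw [hQ', ← aeval_algebraMap_apply]
    congr 2; ext j; fin_cases j <;> rfl
  have halg' : IsAlgebraic K ((Polynomial.C (algebraMap K L k₀ * i y - m) * Polynomial.X +
      Polynomial.C (i (x + (k₀ / 2) • y ^ 2) - (algebraMap K L k₀ * i y - m) * i y) :
      Polynomial L).coeff 1) := by
    refine isAlgebraic_coeff_of_derivation_aeval_eq_zero D (y := i y) hDy1 Q' (hQL' ▸ hDv) ?_ _
      ?_ ?_ 1 le_rfl Polynomial.natDegree_linear_le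
    · rintro c rfl
      apply hvx; rw [hQ']; simp
    · have hX : i (x + (k₀ / 2) • y ^ 2) = i x + algebraMap K L k₀ * i y ^ 2 / 2 := by
        simp only [i, map_add, Algebra.smul_def, map_mul, map_pow,
          ← IsScalarTower.algebraMap_apply, map_div₀, map_ofNat]
        ring
      have h2 : D (i (x + (k₀ / 2) • y ^ 2) - (algebraMap K L k₀ * i y - m) * i y) = 0 := by
        rw [hX]
        simp only [map_add, map_sub, Derivation.leibniz_div, Derivation.leibniz,
          Derivation.leibniz_pow, hDk1, hDx1, hDy1, hDm1, hD2, smul_eq_mul, nsmul_eq_mul]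
        field_simp
        push_cast
        ring
      rintro (_ | _ | j)
      · simpa using h2
      · simpa using hDb
      · simp
    · simp
  obtain ⟨b, hb⟩ := exists_algebraMap_eq_of_isAlgebraic hc halg'
  refine ⟨k₀, b, hinj ?_⟩
  have hm' : m = algebraMap K L k₀ * i y - algebraMap K L b := by
    rw [← hb]; simp
  rw [Algebra.smul_def]
  simp only [map_mul, map_sub, ← IsScalarTower.algebraMap_apply]
  exact hm' ▸ hm

/-- An element constant along the parabolas `x + k y² / 2 - b y = const` is a polynomial in
`x + k y² / 2 - b y`. -/
theorem exists_aeval_eq_of_parabola {x y : R}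
    (hxx : dx x = 1) (hyx : dy x = 0) (hyxy : dx y = 0) (hyy : dy y = 1)
    {v : R} (hv : v ∈ Algebra.adjoin K {x, y}) (k b : K)
    (h : dy v = (k • y - algebraMap K R b) * dx v) :
    ∃ g : Polynomial K, v = Polynomial.aeval (x + (k / 2) • y ^ 2 - b • y) g := by
  have : CharZero R := charZero_of_injective_algebraMap (FaithfulSMul.algebraMap_injective K R)
  set t := x + (k / 2) • y ^ 2 - b • y with ht
  let D : Derivation K R R := dy - (k • y - algebraMap K R b) • dx
  have hD : ∀ f, D f = dy f - (k • y - algebraMap K R b) * dx f := fun f => by simp [D]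
  have hDt : D t = 0 := by
    rw [hD, ht]
    simp only [map_add, map_sub, Derivation.map_smul, Derivation.leibniz_pow, hxx, hyx, hyxy, hyy,
      smul_eq_mul, nsmul_eq_mul]
    simp only [Algebra.smul_def]
    have : algebraMap K R (k / 2) * 2 = algebraMap K R k := by
      rw [← map_ofNat (algebraMap K R) 2, ← map_mul]; congr 1; field_simp
    push_cast
    linear_combination y * this
  have hDy1 : D y = 1 := by rw [hD, hyy, hyxy]; simp
  have hvt : v ∈ Algebra.adjoin K {t, y} := by
    refine Algebra.adjoin_le ?_ hv
    have h1 : t ∈ Algebra.adjoin K {t, y} := Algebra.subset_adjoin (by simp)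
    have h2 : y ∈ Algebra.adjoin K {t, y} := Algebra.subset_adjoin (by simp)
    rintro _ (rfl | rfl)
    · have := Subalgebra.add_mem _ (Subalgebra.sub_mem _ h1
        (Subalgebra.smul_mem _ (Subalgebra.pow_mem _ h2 2) (k / 2))) (Subalgebra.smul_mem _ h2 b)
      rwa [show t - (k / 2) • y ^ 2 + b • y = _ by rw [ht, sub_right_comm, add_sub_cancel_right,
        sub_add_cancel]] at this
    · exact h2
  obtain ⟨q, hq⟩ := exists_aeval_eq_of_mem_adjoin_pair hvt
  let P : Polynomial R := aeval ![Polynomial.C t, Polynomial.X] q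
  have hPe : ∀ s : R, P.eval s = aeval ![t, s] q := fun s => by
    have : ((Polynomial.aeval (R := R) s).restrictScalars K).comp
        (aeval (R := K) ![Polynomial.C t, Polynomial.X]) = aeval ![t, s] := by
      ext i; fin_cases i <;> simp
    have := DFunLike.congr_fun this q
    simpa [P, Polynomial.aeval_def, Polynomial.eval₂_eq_eval_map] using this
  have hPc : ∀ i, D (P.coeff i) = 0 := fun i => by
    have hs : P = Polynomial.map (Polynomial.aeval t).toRingHom
        (aeval ![Polynomial.C Polynomial.X, Polynomial.X] q : Polynomial (Polynomial K)) := by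
      have : (aeval (R := K) ![Polynomial.C t, Polynomial.X] :
            MvPolynomial (Fin 2) K →ₐ[K] Polynomial R) =
          (Polynomial.mapAlgHom (Polynomial.aeval t)).comp
            (aeval ![Polynomial.C Polynomial.X, Polynomial.X]) := by
        ext i; fin_cases i <;> simp
      exact DFunLike.congr_fun this q
    rw [hs, Polynomial.coeff_map]
    simp [Derivation.map_aeval, hDt]
  -- P is v written as a polynomial in y over K[t]; both t and v are constants of D while D y = 1,
  -- so y does not occur and may be set to 0.
  have hP : P = Polynomial.C v := by
    rw [← sub_eq_zero]
    refine Polynomial.eq_zero_of_eval_eq_zero_of_derivation D hDy1 _ (fun i => ?_) ?_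
    · rw [Polynomial.coeff_sub, map_sub, hPc, Polynomial.coeff_C]
      split_ifs
      · rw [hD, h]; simp
      · simp
    · rw [Polynomial.eval_sub, hPe, ← hq]; simp
  refine ⟨aeval ![Polynomial.X, 0] q, ?_⟩
  have h0 := hPe 0
  rw [hP, Polynomial.eval_C] at h0
  have : aeval ![t, 0] = (Polynomial.aeval t).comp
      (aeval ![(Polynomial.X : Polynomial K), 0]) := by
    ext i; fin_cases i <;> simp
  rw [h0, this, AlgHom.comp_apply]

end Plane

/-! ### The nilpotency equations and their z-derivatives, with `a k` the k-th z-derivative of `u`.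
-/

/-- The equations expressing that the Jacobian matrix of `(u, v, h)` is nilpotent, when `h` does
not depend on the third variable and `v` has degree at most one in it. -/
structure NilpotentTriple {K R : Type*} [CommRing K] [CommRing R] [Algebra K R]
    (dx dy dz : Derivation K R R) (u v h : R) : Prop where
  comm_xy : ∀ f, dx (dy f) = dy (dx f)
  comm_zx : ∀ f, dz (dx f) = dx (dz f)
  comm_zy : ∀ f, dz (dy f) = dy (dz f)
  hz : dz h = 0
  vzz : dz (dz v) = 0
  trace : dx u + dy v = 0
  minors : dy v ^ 2 + dy u * dx v + dz u * dx h + dz v * dy h = 0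
  det : dx h * (dy u * dz v - dz u * dy v) + dy h * (dy v * dz v + dz u * dx v) = 0

namespace NilpotentTriple

section Iterates

variable {K R : Type*} [CommRing K] [CommRing R] [Algebra K R]
  {dx dy dz : Derivation K R R} {v h : R} {a : ℕ → R}

section

variable (S : NilpotentTriple dx dy dz (a 0) v h) (ha : ∀ k, dz (a k) = a (k + 1))
include S ha

theorem trace_one : dx (a 1) + dy (dz v) = 0 := by
  have := congrArg dz S.trace
  simpa only [map_add, map_zero, S.comm_zx, S.comm_zy, ha] using this

theorem trace_add_two (k : ℕ) : dx (a (k + 2)) = 0 := by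
  induction k with
  | zero =>
    have := congrArg dz (S.trace_one ha)
    simpa only [map_add, map_zero, S.comm_zx, S.comm_zy, ha, S.vzz, add_zero] using this
  | succ k ih =>
    have := congrArg dz ih
    simpa only [map_zero, S.comm_zx, ha] using this

theorem minors_one : 2 * dy v * dy (dz v) + dy (a 1) * dx v + dy (a 0) * dx (dz v) +
    a 2 * dx h = 0 := by
  have := congrArg dz S.minors
  simp only [map_add, map_zero, Derivation.leibniz, Derivation.leibniz_pow, smul_eq_mul,
    nsmul_eq_mul, S.comm_zx, S.comm_zy, ha, S.vzz, S.hz] at this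
  push_cast at this
  linear_combination this

theorem minors_two : 2 * dy (dz v) ^ 2 + dy (a 2) * dx v + 2 * dy (a 1) * dx (dz v) +
    a 3 * dx h = 0 := by
  have h2 : dz 2 = 0 := mod_cast dz.map_natCast 2
  have := congrArg dz (S.minors_one ha)
  simp only [map_add, map_zero, Derivation.leibniz, smul_eq_mul, h2,
    S.comm_zx, S.comm_zy, ha, S.vzz, S.hz] at this
  linear_combination this

/-- Since v_zz = 0, Leibniz leaves only two terms from u_y v_x, the second with the order of
differentiation as factor; the square of v_y has vanished after three derivatives. -/
theorem minors_add_three (k : ℕ) : dy (a (k + 3)) * dx v +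
    (k + 3 : ℕ) * dy (a (k + 2)) * dx (dz v) + a (k + 4) * dx h = 0 := by
  induction k with
  | zero =>
    have h2 : dz 2 = 0 := mod_cast dz.map_natCast 2
    have := congrArg dz (S.minors_two ha)
    simp only [map_add, map_zero, Derivation.leibniz, Derivation.leibniz_pow, smul_eq_mul,
      nsmul_eq_mul, h2, S.comm_zx, S.comm_zy, ha, S.vzz, S.hz] at this
    push_cast
    linear_combination this
  | succ k ih =>
    have := congrArg dz ih
    simp only [map_add, map_zero, Derivation.leibniz, smul_eq_mul,
      Derivation.map_natCast, S.comm_zx, S.comm_zy, ha, S.vzz, S.hz] at this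
    push_cast at this ⊢
    linear_combination this

theorem det_one : dx h * (dy (a 1) * dz v - a 2 * dy v - a 1 * dy (dz v)) +
    dy h * (dy (dz v) * dz v + a 2 * dx v + a 1 * dx (dz v)) = 0 := by
  have := congrArg dz S.det
  simp only [map_add, map_sub, map_zero, Derivation.leibniz, smul_eq_mul,
    S.comm_zx, S.comm_zy, ha, S.vzz, S.hz] at this
  linear_combination this

theorem det_add_two (k : ℕ) : dx h * (dy (a (k + 2)) * dz v - a (k + 3) * dy v -
      (k + 2 : ℕ) * a (k + 2) * dy (dz v)) +
    dy h * (a (k + 3) * dx v + (k + 2 : ℕ) * a (k + 2) * dx (dz v)) = 0 := by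
  induction k with
  | zero =>
    have := congrArg dz (S.det_one ha)
    simp only [map_add, map_sub, map_zero, Derivation.leibniz, smul_eq_mul,
      S.comm_zx, S.comm_zy, ha, S.vzz, S.hz] at this
    push_cast
    linear_combination this
  | succ k ih =>
    have := congrArg dz ih
    simp only [map_add, map_sub, map_zero, Derivation.leibniz, smul_eq_mul,
      Derivation.map_natCast, S.comm_zx, S.comm_zy, ha, S.vzz, S.hz] at this
    push_cast at this ⊢
    linear_combination this

end

end Iterates

/-! ### Bounding the z-degree of `u`. -/

section Degree

variable {K R : Type*} [Field K] [CommRing R] [IsDomain R] [CharZero R] [Algebra K R]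
  {dx dy dz : Derivation K R R} {v h : R} {a : ℕ → R}
  (S : NilpotentTriple dx dy dz (a 0) v h) (ha : ∀ k, dz (a k) = a (k + 1))
  (hv : ¬ (dx v = 0 ∧ dy v = 0 ∧ dz v = 0)) (hh : ¬ (dx h = 0 ∧ dy h = 0))
include S ha hv hh

/-- The leading coefficient of `u` with respect to the third variable, if its degree is at least
two, does not depend on the second variable. -/
theorem dy_leading_eq_zero
    (hdvd : ∀ (p q : R) (n : ℕ), 2 ≤ n → p ≠ 0 → dx p = 0 → dz p = 0 → dx q = 0 → dz q = 0 →
      dy q ≠ 0 → n * (p * dy q) = dy p * q → ¬ p ∣ q * dy q ∧ ¬ p ∣ 2 * dy q ^ 2)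
    {m : ℕ} (hm : a (m + 2) ≠ 0) (hm' : a (m + 3) = 0) : dy (a (m + 2)) = 0 := by
  by_contra hay
  have hm4 : a (m + 4) = 0 := by rw [← ha, hm', map_zero]
  have hax := S.trace_add_two ha m
  have haz : dz (a (m + 2)) = 0 := by rw [ha, hm']
  have hwx : dx (dz v) = 0 := by
    have h1 := S.minors_add_three ha m
    rw [hm', hm4] at h1
    have h2 : ((m + 3 : ℕ) : R) * dy (a (m + 2)) ≠ 0 :=
      mul_ne_zero (Nat.cast_ne_zero.2 (by omega)) hay
    refine (mul_eq_zero.1 ?_).resolve_left h2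
    simpa using h1
  have hdet := S.det_add_two ha m
  rw [hm', hwx] at hdet
  -- The z-derivative of order m + 2 of the minors equation; the square of v_zy survives only at
  -- order two.
  have hmin : (m = 0 ∧ 2 * dy (dz v) ^ 2 + dy (a (m + 2)) * dx v = 0) ∨ (1 ≤ m ∧ dx v = 0) := by
    rcases m with _ | m
    · left
      have := S.minors_two ha
      rw [hm', hwx] at this
      exact ⟨rfl, by linear_combination this⟩
    · right
      have := S.minors_add_three ha m
      rw [hm', hwx] at this
      refine ⟨by omega, (mul_eq_zero.1 ?_).resolve_left hay⟩
      linear_combination this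
  have hw : dz v ≠ 0 := by
    intro hw
    have hvx : dx v = 0 := by
      rcases hmin with ⟨-, h1⟩ | ⟨-, h1⟩
      · rw [hw, map_zero] at h1
        refine (mul_eq_zero.1 ?_).resolve_left hay
        linear_combination h1
      · exact h1
    have h1 := S.minors
    have h2 := S.det
    rw [hw, hvx] at h1 h2
    have : dy v ^ 3 = 0 := by linear_combination dy v * h1 + h2
    exact hv ⟨hvx, by simpa using this, hw⟩
  by_cases hx : dx h = 0
  · have hy : dy h ≠ 0 := fun hy => hh ⟨hx, hy⟩
    have g0 : dy v * dz v + a 1 * dx v = 0 := by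
      have := S.det
      rw [hx, ha] at this
      refine (mul_eq_zero.1 ?_).resolve_left hy
      linear_combination this
    have g1 : dy (dz v) * dz v + a 2 * dx v = 0 := by
      have := congrArg dz g0
      simp only [map_add, map_zero, Derivation.leibniz, smul_eq_mul, S.comm_zx, S.comm_zy, S.vzz,
        hwx, ha] at this
      linear_combination this
    have hvx : dx v ≠ 0 := by
      intro hvx
      have h1 : dy v = 0 := by
        refine (mul_eq_zero.1 ?_).resolve_right hw
        rw [hvx] at g0; linear_combination g0
      have h2 := S.minors
      rw [hvx, h1, hx] at h2
      have h3 : dz v * dy h = 0 := by linear_combination h2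
      exact (mul_ne_zero hw hy) h3
    obtain ⟨rfl, h2⟩ := hmin.resolve_right fun h => hvx h.2
    have hwy : dy (dz v) ≠ 0 := by
      intro hwy
      rw [hwy] at g1
      have : a 2 * dx v = 0 := by linear_combination g1
      exact mul_ne_zero hm hvx this
    -- `g1` exhibits a₂ as a divisor of v_z v_zy; with `h2` it also yields 2 a₂ v_zy = a₂_y v_z.
    refine (hdvd (a 2) (dz v) 2 le_rfl hm hax haz hwx S.vzz hwy ?_).1 ⟨-dx v, ?_⟩
    · apply mul_right_cancel₀ hvx
      push_cast
      linear_combination 2 * dy (dz v) * g1 - dz v * h2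
    · linear_combination g1
  -- This relation puts a on the footing of a constant times the power m + 2 of v_z. The minors
  -- equations then make a divide v_z v_zy for m = 0 and 2 v_zy² for m = 1, and give a h_x = 0 for
  -- larger m.
  · have hrel : ((m + 2 : ℕ) : R) * (a (m + 2) * dy (dz v)) = dy (a (m + 2)) * dz v := by
      apply mul_left_cancel₀ hx
      linear_combination -hdet
    have hwy : dy (dz v) ≠ 0 := by
      intro hwy
      rw [hwy] at hrel
      have : dy (a (m + 2)) * dz v = 0 := by linear_combination -hrel
      exact mul_ne_zero hay hw this
    have hnd := hdvd _ _ (m + 2) (by omega) hm hax haz hwx S.vzz hwy hrel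
    rcases hmin with ⟨rfl, h2⟩ | ⟨h1m, hvx⟩
    · refine hnd.1 ⟨-dx v, ?_⟩
      apply mul_left_cancel₀ (mul_ne_zero (two_ne_zero (α := R)) hwy)
      push_cast at hrel
      linear_combination dz v * h2 + dx v * hrel
    · obtain ⟨m, rfl⟩ : ∃ j, m = j + 1 := ⟨m - 1, by omega⟩
      rcases m with _ | m
      · refine hnd.2 ⟨-dx h, ?_⟩
        have := S.minors_two ha
        rw [hvx, hwx] at this
        linear_combination this
      · have := S.minors_add_three ha m
        rw [hvx, hwx] at this
        refine mul_ne_zero hm hx ?_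
        linear_combination this

/-- The leading coefficient of `u` with respect to the third variable, if its degree is at least
two, is not constant. -/
theorem leading_not_constant (hc : ∀ f, dx f = 0 → dy f = 0 → dz f = 0 → ∃ c, f = algebraMap K R c)
    (hind : ∀ b c : K, h ≠ b • v + algebraMap K R c)
    {m : ℕ} (hm : a (m + 2) ≠ 0) (hm' : a (m + 3) = 0) (hay : dy (a (m + 2)) = 0) : False := by
  have hzero : ∀ k, a k = 0 → ∀ j, a (k + j) = 0 := fun k hk j => by
    induction j with
    | zero => exact hk
    | succ j ih => rw [← add_assoc, ← ha, ih, map_zero]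
  have hax := S.trace_add_two ha m
  have haz : dz (a (m + 2)) = 0 := by rw [ha, hm']
  have hm2 : ((m + 2 : ℕ) : R) ≠ 0 := Nat.cast_ne_zero.2 (by omega)
  have hJ : dx h * dy (dz v) = dy h * dx (dz v) := by
    have hdet := S.det_add_two ha m
    rw [hm', hay] at hdet
    apply mul_left_cancel₀ (mul_ne_zero hm2 hm)
    linear_combination -hdet
  have h2 := S.minors
  have h3 := S.det
  rw [ha] at h2 h3
  by_cases hwx : dx (dz v) = 0
  · by_cases hwy : dy (dz v) = 0
    · obtain ⟨c, hac⟩ := hc _ hax hay haz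
      have hc0 : c ≠ 0 := by rintro rfl; simp at hac; exact hm hac
      set p := dy (a (m + 1)) with hp
      have h4 : p * dx v + a (m + 2) * dx h = 0 := by
        rcases m with _ | _ | m
        · have := S.minors_one ha
          rw [hwx, hwy] at this; linear_combination this
        · have := S.minors_two ha
          rw [hwx, hwy] at this; linear_combination this
        · have := S.minors_add_three ha m
          rw [hwx] at this; linear_combination this
      have h5 : dx h * p * dz v + a (m + 2) * (dy h * dx v - dx h * dy v) = 0 := by
        rcases m with _ | m
        · have := S.det_one ha
          rw [hwx, hwy] at this; linear_combination this
        · have := S.det_add_two ha m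
          rw [hwx, hwy] at this; linear_combination this
      have hpx : dx p = 0 := by
        rw [hp, S.comm_xy]
        rcases m with _ | m
        · have := S.trace_one ha
          rw [hwy, add_zero] at this
          rw [this, map_zero]
        · rw [S.trace_add_two ha, map_zero]
      have hpz : dz p = 0 := by rw [hp, S.comm_zy, ha, hay]
      -- The leading coefficient is a nonzero constant, so p can be divided by it; the sign makes
      -- h_x = q v_x.
      obtain ⟨q, hq⟩ : ∃ q, p = -(a (m + 2) * q) := ⟨-(algebraMap K R c⁻¹ * p), by
        rw [hac, mul_neg, neg_neg, ← mul_assoc, ← map_mul, mul_inv_cancel₀ hc0, map_one, one_mul]⟩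
      have hqx : dx q = 0 := by
        have := hpx
        rw [hq, map_neg, Derivation.leibniz, hax, smul_zero, add_zero, smul_eq_mul, neg_eq_zero]
          at this
        exact (mul_eq_zero.1 this).resolve_left hm
      have hqz : dz q = 0 := by
        have := hpz
        rw [hq, map_neg, Derivation.leibniz, haz, smul_zero, add_zero, smul_eq_mul, neg_eq_zero]
          at this
        exact (mul_eq_zero.1 this).resolve_left hm
      have hhx : dx h = q * dx v := by
        apply mul_left_cancel₀ hm
        rw [hq] at h4
        linear_combination h4
      by_cases hvx : dx v = 0
      · have hhx0 : dx h = 0 := by rw [hhx, hvx, mul_zero]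
        have hhy : dy h ≠ 0 := fun hy => hh ⟨hhx0, hy⟩
        rw [hhx0, hvx] at h2 h3
        have h6 : dy v ^ 3 = 0 := by linear_combination dy v * h2 - h3
        have h7 : dy v = 0 := by simpa using h6
        rw [h7] at h2
        have h8 : dz v * dy h = 0 := by linear_combination h2
        exact hv ⟨hvx, h7, (mul_eq_zero.1 h8).resolve_right hhy⟩
      · have hhy : dy h = q * dy v + q ^ 2 * dz v := by
          apply mul_right_cancel₀ (mul_ne_zero hm hvx)
          rw [hq, hhx] at h5
          linear_combination h5
        have hqy : dy q = 0 := by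
          have h6 := S.comm_xy h
          rw [hhx, hhy] at h6
          simp only [map_add, Derivation.leibniz, Derivation.leibniz_pow, smul_eq_mul,
            nsmul_eq_mul, hqx, hwx, S.comm_xy v] at h6
          refine (mul_eq_zero.1 ?_).resolve_right hvx
          linear_combination -h6
        -- Either q = 0 and h is constant, or v_z = 0 and h - q v is constant with q in K; both are
        -- excluded.
        have h7 : (q * dz v) ^ 3 = 0 := by
          rw [hhx, hhy] at h2 h3
          linear_combination q * dz v * h2 - h3
        rcases mul_eq_zero.1 ((pow_eq_zero_iff three_ne_zero).1 h7) with h8 | h8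
        · exact hh ⟨by rw [hhx, h8, zero_mul], by rw [hhy, h8]; ring⟩
        · obtain ⟨b, rfl⟩ := hc q hqx hqy hqz
          obtain ⟨e, he⟩ := hc (h - b • v) (by simp [hhx, Algebra.smul_def])
            (by simp [hhy, h8, Algebra.smul_def]) (by simp [S.hz, h8])
          exact hind b e (by rw [← he]; abel)
    · have hx : dx h = 0 := by
        rw [hwx, mul_zero] at hJ
        exact (mul_eq_zero.1 hJ).resolve_right hwy
      have hy : dy h ≠ 0 := fun hy => hh ⟨hx, hy⟩
      have hw : dz v ≠ 0 := fun hw => hwy (by rw [hw, map_zero])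
      have g0 : dy v * dz v + a 1 * dx v = 0 := by
        rw [hx] at h3
        refine (mul_eq_zero.1 ?_).resolve_left hy
        linear_combination h3
      have g1 : dy (dz v) * dz v + a 2 * dx v = 0 := by
        have := congrArg dz g0
        simp only [map_add, map_zero, Derivation.leibniz, smul_eq_mul, S.comm_zx, S.comm_zy, S.vzz,
          hwx, ha] at this
        linear_combination this
      have g2 : a 3 * dx v = 0 := by
        have := congrArg dz g1
        simp only [map_add, map_zero, Derivation.leibniz, smul_eq_mul, S.comm_zx, S.comm_zy, S.vzz,
          hwx, ha] at this
        linear_combination this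
      have hvx : dx v ≠ 0 := by
        intro hvx
        refine mul_ne_zero hwy hw ?_
        rw [hvx] at g1; linear_combination g1
      have h6 := (mul_eq_zero.1 g2).resolve_right hvx
      rcases m with _ | m
      · have := S.minors_two ha
        rw [hm', hwx, hay] at this
        refine mul_ne_zero (two_ne_zero (α := R)) (pow_ne_zero 2 hwy) ?_
        linear_combination this
      · exact hm (by rw [← hzero 3 h6 m]; congr 1; omega)
  · have hx : dx h ≠ 0 := fun hx => hh ⟨hx, by
      rw [hx, zero_mul] at hJ
      exact (mul_eq_zero.1 hJ.symm).resolve_right hwx⟩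
    have hw : dz v ≠ 0 := fun hw => hwx (by rw [hw, map_zero])
    -- Parallel gradients of v and h in the plane reduce the determinant and minors equations to a₁
    -- h_x + v_z h_y = 0, whose z-derivative is a₂ h_x = 0.
    have hD : dy h * dx v = dx h * dy v := by
      apply mul_left_cancel₀ hm
      rcases m with _ | m
      · have e1 := S.minors_two ha
        have e2 := S.det_one ha
        rw [hm', hay] at e1
        have e3 : dx h * dy (a 1) = -(dy h * dy (dz v)) := by
          apply mul_right_cancel₀ (mul_ne_zero (two_ne_zero (α := R)) hwx)
          linear_combination dx h * e1 - 2 * dy (dz v) * hJ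
        linear_combination e2 - dz v * e3 + a 1 * hJ
      · have e1 := S.minors_add_three ha m
        rw [hm', hay] at e1
        have e2 : dy (a (m + 1 + 1)) = 0 := by
          apply mul_left_cancel₀ (mul_ne_zero (Nat.cast_ne_zero.2 (by omega : m + 3 ≠ 0)) hwx)
          linear_combination e1
        have e3 := S.det_add_two ha m
        rw [e2] at e3
        linear_combination e3 + ((m + 2 : ℕ) : R) * a (m + 2) * hJ
    have h4 : dx h * dy (a 0) + dy h * dy v = 0 := by
      apply mul_left_cancel₀ hw
      linear_combination h3 - a 1 * hD
    have h5 : a 1 * dx h + dz v * dy h = 0 := by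
      apply mul_left_cancel₀ hx
      linear_combination dx h * h2 - dx v * h4 + dy v * hD
    have h6 : a 2 * dx h = 0 := by
      have := congrArg dz h5
      simp only [map_add, map_zero, Derivation.leibniz, smul_eq_mul, S.comm_zx, S.comm_zy, S.vzz,
        S.hz, ha] at this
      linear_combination this
    exact hm (by
      rw [← hzero 2 ((mul_eq_zero.1 h6).resolve_right hx) m]; congr 1; omega)

end Degree

end NilpotentTriple

/-! ### Partial derivatives and degrees of polynomials. -/

section Poly
variable {K : Type*} [Field K] [CharZero K] {σ : Type*}

theorem MvPolynomial.coeff_eq_zero_of_pderiv_eq_zero {i : σ} {f : MvPolynomial σ K}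
    (h : pderiv i f = 0) {m : σ →₀ ℕ} (hm : m i ≠ 0) : coeff m f = 0 := by
  classical
  have h1 := coeff_pderiv (i := i) f (m - Finsupp.single i 1)
  rw [h, coeff_zero, tsub_add_cancel_of_le (by simpa using Nat.one_le_iff_ne_zero.2 hm)] at h1
  exact (mul_eq_zero.1 h1.symm).resolve_right (Nat.cast_add_one_ne_zero _)

theorem MvPolynomial.eq_C_of_pderiv_eq_zero {f : MvPolynomial σ K}
    (h : ∀ i, pderiv i f = 0) : f = C (coeff 0 f) := by
  classical
  ext m
  rw [coeff_C]
  split_ifs with hm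
  · rw [hm]
  · obtain ⟨i, hi⟩ := Finsupp.ne_iff.1 (Ne.symm hm)
    exact coeff_eq_zero_of_pderiv_eq_zero (h i) hi

theorem MvPolynomial.mem_adjoin_of_pderiv_two_eq_zero {f : MvPolynomial (Fin 3) K}
    (h : pderiv 2 f = 0) : f ∈ Algebra.adjoin K {(X 0 : MvPolynomial (Fin 3) K), X 1} := by
  have h1 : f ∈ supported K ({0, 1} : Set (Fin 3)) := by
    rw [mem_supported]
    intro i hi
    obtain ⟨m, hm, hmi⟩ := (mem_vars_iff_mem_support _).1 hi
    fin_cases i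
    · simp
    · simp
    · exact absurd (coeff_eq_zero_of_pderiv_eq_zero h (Finsupp.mem_support_iff.1 hmi))
        (mem_support_iff.1 hm)
  rwa [supported_eq_adjoin_X, Set.image_pair] at h1

omit [CharZero K] in
theorem MvPolynomial.pderiv_eq_zero_of_degreeOf {i : σ} {f : MvPolynomial σ K}
    (h : degreeOf i f = 0) : pderiv i f = 0 := by
  classical
  ext m
  rw [coeff_pderiv, coeff_zero]
  by_contra hc
  have := monomial_le_degreeOf i (mem_support_iff.2 (left_ne_zero_of_mul hc))
  simp [h] at this

omit [CharZero K] in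
theorem MvPolynomial.degreeOf_pderiv_le {i : σ} (f : MvPolynomial σ K) :
    degreeOf i (pderiv i f) ≤ degreeOf i f - 1 := by
  classical
  rw [degreeOf_le_iff]
  intro m hm
  rw [mem_support_iff, coeff_pderiv] at hm
  have := monomial_le_degreeOf i (mem_support_iff.2 (left_ne_zero_of_mul hm))
  simp at this
  omega

omit [CharZero K] in
theorem MvPolynomial.pderiv_iterate_eq_zero {i : σ} (f : MvPolynomial σ K) {n : ℕ}
    (hn : degreeOf i f < n) : (pderiv i)^[n] f = 0 := by
  induction n generalizing f with
  | zero => omega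
  | succ n ih =>
    rw [Function.iterate_succ_apply]
    rcases Nat.eq_zero_or_pos (degreeOf i f) with h | h
    · rw [pderiv_eq_zero_of_degreeOf h, ← Derivation.coeFn_coe]
      exact Function.iterate_fixed (map_zero _) _
    · exact ih _ (by have := degreeOf_pderiv_le (i := i) f; omega)

omit [CharZero K] in
theorem MvPolynomial.pderiv_pderiv_comm (i j : σ) (f : MvPolynomial σ K) :
    pderiv i (pderiv j f) = pderiv j (pderiv i f) := by
  classical
  rw [← sub_eq_zero, ← Derivation.commutator_apply]
  have : ⁅(pderiv i : Derivation K (MvPolynomial σ K) (MvPolynomial σ K)),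
      (pderiv j : Derivation K (MvPolynomial σ K) (MvPolynomial σ K))⁆ = 0 := by
    refine derivation_ext fun k => ?_
    simp only [Derivation.commutator_apply, pderiv_X, Pi.single_apply]
    split_ifs <;> simp
  rw [this]; rfl

/-- If `n a b' = a' b`, then `a` has `n` times the degree of `b`. -/
theorem Polynomial.natDegree_eq_of_mul_derivative_eq {a b : Polynomial K} {n : ℕ}
    (ha : a ≠ 0) (hb : b.derivative ≠ 0)
    (h : (n : Polynomial K) * (a * b.derivative) = a.derivative * b) :
    a.natDegree = n * b.natDegree := by
  have hbd : b.natDegree ≠ 0 := fun h0 => hb (Polynomial.derivative_eq_zero.2 h0)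
  have hb0 : b ≠ 0 := by rintro rfl; simp at hb
  by_cases had : a.natDegree = 0
  · have h0 : Polynomial.derivative a = 0 := Polynomial.derivative_eq_zero.2 had
    rw [h0, zero_mul] at h
    have : (n : Polynomial K) = 0 := by simpa [ha, hb] using h
    have : n = 0 := by exact_mod_cast this
    simp [had, this]
  -- Compare the coefficients in degree deg a + deg b - 1, the highest possible on both sides.
  have h1 := congrArg (fun p => p.coeff (a.natDegree + (b.natDegree - 1))) h
  have e : a.natDegree + (b.natDegree - 1) = (a.natDegree - 1) + b.natDegree := by omega
  simp only [← Polynomial.C_eq_natCast, Polynomial.coeff_C_mul] at h1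
  rw [Polynomial.coeff_mul_add_eq_of_natDegree_le le_rfl (Polynomial.natDegree_derivative_le b), e,
    Polynomial.coeff_mul_add_eq_of_natDegree_le (Polynomial.natDegree_derivative_le a) le_rfl,
    Polynomial.coeff_derivative, Polynomial.coeff_derivative] at h1
  have e1 : a.natDegree - 1 + 1 = a.natDegree := by omega
  have e2 : b.natDegree - 1 + 1 = b.natDegree := by omega
  have c1 : ((a.natDegree - 1 : ℕ) : K) + 1 = a.natDegree := by exact_mod_cast e1
  have c2 : ((b.natDegree - 1 : ℕ) : K) + 1 = b.natDegree := by exact_mod_cast e2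
  rw [e1, e2, c1, c2] at h1
  have hla : a.coeff a.natDegree ≠ 0 := by simpa using ha
  have hlb : b.coeff b.natDegree ≠ 0 := by simpa using hb0
  have : ((a.natDegree : ℕ) : K) = ((n * b.natDegree : ℕ) : K) := by
    push_cast
    apply mul_right_cancel₀ (mul_ne_zero hla hlb)
    linear_combination -h1
  exact_mod_cast this

theorem MvPolynomial.exists_aeval_X_of_pderiv_eq_zero {i : σ} {f : MvPolynomial σ K}
    (h : ∀ j, j ≠ i → pderiv j f = 0) :
    ∃ p : Polynomial K, f = Polynomial.aeval (X i) p := by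
  have h1 : f ∈ supported K ({i} : Set σ) := by
    rw [mem_supported]
    intro j hj
    obtain ⟨m, hm, hmj⟩ := (mem_vars_iff_mem_support _).1 hj
    by_contra hji
    exact absurd (coeff_eq_zero_of_pderiv_eq_zero (h j hji) (Finsupp.mem_support_iff.1 hmj))
        (mem_support_iff.1 hm)
  rw [supported_eq_adjoin_X, Set.image_singleton, Algebra.adjoin_singleton_eq_range_aeval] at h1
  obtain ⟨p, hp⟩ := h1
  exact ⟨p, hp.symm⟩


/-- If `a` and `b` depend on one variable and `a` is a constant multiple of `b ^ n` with `2 ≤ n`,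
then `a` does not divide the products `b * b'` and `2 * b' ^ 2`. -/
theorem MvPolynomial.not_dvd_of_mul_pderiv_eq {i : σ} {a b : MvPolynomial σ K} {n : ℕ} (hn : 2 ≤ n)
    (ha0 : a ≠ 0) (ha : ∀ j, j ≠ i → pderiv j a = 0) (hb : ∀ j, j ≠ i → pderiv j b = 0)
    (hb0 : pderiv i b ≠ 0) (h : (n : MvPolynomial σ K) * (a * pderiv i b) = pderiv i a * b) :
    ¬ a ∣ b * pderiv i b ∧ ¬ a ∣ 2 * pderiv i b ^ 2 := by
  classical
  obtain ⟨A, rfl⟩ := exists_aeval_X_of_pderiv_eq_zero ha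
  obtain ⟨B, rfl⟩ := exists_aeval_X_of_pderiv_eq_zero hb
  -- Setting the other variables to 0 inverts the inclusion of K[X i] and carries divisibility to
  -- one variable, where deg A = n deg B ≥ 2 deg B exceeds the degrees of B B' and 2 B'².
  let φ : MvPolynomial σ K →ₐ[K] Polynomial K := aeval (Pi.single i Polynomial.X)
  have hφ : ∀ p, φ (Polynomial.aeval (X i) p) = p := fun p => by
    rw [← Polynomial.aeval_algHom_apply]
    simp [φ]
  have hd : ∀ p : Polynomial K, pderiv i (Polynomial.aeval (X i : MvPolynomial σ K) p) =
      Polynomial.aeval (X i) (Polynomial.derivative p) := fun p => by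
    rw [Derivation.map_aeval]; simp
  rw [hd] at hb0 h ⊢
  rw [hd] at h
  have hA : A ≠ 0 := by rintro rfl; simp at ha0
  have hB : Polynomial.derivative B ≠ 0 := by intro h0; simp [h0] at hb0
  have hB0 : B ≠ 0 := by rintro rfl; simp at hB
  have h' := congrArg φ h
  simp only [map_mul, map_natCast, hφ] at h'
  have hdeg := Polynomial.natDegree_eq_of_mul_derivative_eq hA hB h'
  have hbd : B.natDegree ≠ 0 := fun h0 => hB (Polynomial.derivative_eq_zero.2 h0)
  have hle := Polynomial.natDegree_derivative_le B
  have hn' : 2 * B.natDegree ≤ n * B.natDegree := Nat.mul_le_mul_right _ hn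
  constructor <;> intro hdvd <;> have h1 := map_dvd φ hdvd <;>
    simp only [map_mul, map_pow, map_ofNat, hφ] at h1
  · have := Polynomial.natDegree_le_of_dvd h1 (mul_ne_zero hB0 hB)
    rw [Polynomial.natDegree_mul hB0 hB] at this
    omega
  · have h2 : (2 : Polynomial K) ≠ 0 := two_ne_zero
    have := Polynomial.natDegree_le_of_dvd h1 (mul_ne_zero h2 (pow_ne_zero 2 hB))
    rw [Polynomial.natDegree_mul h2 (pow_ne_zero 2 hB), Polynomial.natDegree_pow] at this
    simp at this
    omega

end Poly

/-! ### Linear changes of coordinates and the normal form. -/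

namespace NilpotentTriple

section LinearChange

variable {K R : Type*} [CommRing K] [CommRing R] [Algebra K R]
  {dx dy dz : Derivation K R R} {u v h : R}

/-- The nilpotency equations are invariant under unimodular linear changes of the first two
coordinates. -/
theorem linear_change (S : NilpotentTriple dx dy dz u v h) (huz : dz (dz u) = 0)
    {s r s' r' : K} (hdet : s * r' - r * s' = 1) :
    NilpotentTriple (r' • dx - s' • dy) (s • dy - r • dx) dz (s • u + r • v) (s' • u + r' • v) h := by
  have hd : algebraMap K R s * algebraMap K R r' - algebraMap K R r * algebraMap K R s' = 1 := by
    rw [← map_mul, ← map_mul, ← map_sub, hdet, map_one]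
  have ht : dx u = -dy v := by linear_combination S.trace
  have h2 := S.minors
  have h3 := S.det
  constructor
  · intro f
    simp only [Derivation.sub_apply, Derivation.smul_apply, map_sub, Derivation.map_smul, S.comm_xy,
      smul_sub, smul_smul, mul_comm]
    abel
  · intro f
    simp only [Derivation.sub_apply, Derivation.smul_apply, map_sub, Derivation.map_smul, S.comm_zx,
      S.comm_zy]
  · intro f
    simp only [Derivation.sub_apply, Derivation.smul_apply, map_sub, Derivation.map_smul, S.comm_zx,
      S.comm_zy]
  · exact S.hz
  · simp [huz, S.vzz]
  · simp only [Derivation.sub_apply, Derivation.smul_apply, map_add, Derivation.map_smul, ht]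
    simp only [Algebra.smul_def]
    ring
  · simp only [Derivation.sub_apply, Derivation.smul_apply, map_add, Derivation.map_smul, ht]
    simp only [Algebra.smul_def]
    linear_combination h2 + hd * ((algebraMap K R s * algebraMap K R r' -
      algebraMap K R r * algebraMap K R s' + 1) * (dy v ^ 2 + dy u * dx v) +
      dz u * dx h + dz v * dy h)
  · simp only [Derivation.sub_apply, Derivation.smul_apply, map_add, Derivation.map_smul, ht]
    simp only [Algebra.smul_def]
    linear_combination (algebraMap K R s * algebraMap K R r' -
      algebraMap K R r * algebraMap K R s') ^ 2 * h3

end LinearChange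

section Classification

variable {K R : Type*} [Field K] [CharZero K] [CommRing R] [IsDomain R] [Algebra K R]
  {dx dy dz : Derivation K R R} {u v h : R}

/-- The trace gives v_zy = 0. If v_zx ≠ 0, the z-derivatives of the other equations give u_y = 0 and
h_y u_z = 0; in either case v_y³ = 0, and then `u` has zero gradient. -/
theorem dz_constant_of_dz_fst_constant (S : NilpotentTriple dx dy dz u v h)
    (hu : ¬ (dx u = 0 ∧ dy u = 0 ∧ dz u = 0)) (hh : ¬ (dx h = 0 ∧ dy h = 0))
    (hux : dx (dz u) = 0) (huy : dy (dz u) = 0) (huz : dz (dz u) = 0) :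
    dx (dz v) = 0 ∧ dy (dz v) = 0 := by
  have : CharZero R := charZero_of_injective_algebraMap (FaithfulSMul.algebraMap_injective K R)
  have ht := congrArg dz S.trace
  rw [map_add, S.comm_zx, S.comm_zy, map_zero, hux, zero_add] at ht
  refine ⟨?_, ht⟩
  by_contra hwx
  have hdu : dy u = 0 := by
    have := congrArg dz S.minors
    simp only [map_add, map_zero, Derivation.leibniz, Derivation.leibniz_pow, smul_eq_mul,
      nsmul_eq_mul, S.comm_zx, S.comm_zy, S.vzz, S.hz, ht, huy, huz] at this
    refine (mul_eq_zero.1 ?_).resolve_right hwx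
    linear_combination this
  have h1 : dy h * dz u = 0 := by
    have := congrArg dz S.det
    simp only [map_add, map_sub, map_zero, Derivation.leibniz, smul_eq_mul,
      S.comm_zx, S.comm_zy, S.vzz, S.hz, ht, huy, huz] at this
    refine (mul_eq_zero.1 ?_).resolve_right hwx
    linear_combination this
  have h2 := S.minors
  have h3 := S.det
  rw [hdu] at h2 h3
  rcases mul_eq_zero.1 h1 with hy | hk
  · have hx : dx h ≠ 0 := fun hx => hh ⟨hx, hy⟩
    rw [hy] at h2 h3
    have h4 : dy v ^ 3 = 0 := by linear_combination dy v * h2 + h3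
    have h5 : dy v = 0 := by simpa using h4
    rw [h5] at h2
    have h6 : dz u * dx h = 0 := by linear_combination h2
    exact hu ⟨by linear_combination S.trace - h5, hdu, (mul_eq_zero.1 h6).resolve_right hx⟩
  · rw [hk] at h2 h3
    have h4 : dy v ^ 3 = 0 := by linear_combination dy v * h2 - h3
    have h5 : dy v = 0 := by simpa using h4
    exact hu ⟨by linear_combination S.trace - h5, hdu, hk⟩

omit [CharZero K] in
theorem exists_unimodular_completion {s r : K} (h : s ≠ 0 ∨ r ≠ 0) :
    ∃ s' r' : K, s * r' - r * s' = 1 := by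
  rcases h with h | h
  · exact ⟨0, s⁻¹, by field_simp; simp⟩
  · exact ⟨-r⁻¹, 0, by field_simp; simp⟩

/-- The independence of `u`, `v`, `h` modulo constants. -/
def IndependentModConstants (K : Type*) {R : Type*} [CommRing K] [CommRing R] [Algebra K R]
    (u v h : R) : Prop :=
  ∀ a b c d : K, a • u + b • v + c • h = algebraMap K R d → a = 0 ∧ b = 0 ∧ c = 0

/-- The planar lemma serves twice: for (u_z, v_z), to make one combination constant, and for (u, v)
itself, to exclude u_z = v_z = 0. -/
theorem exists_dz_constant [IsIntegrallyClosed R] (S : NilpotentTriple dx dy dz u v h)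
    (hI : IndependentModConstants K u v h)
    (hc : ∀ f, dx f = 0 → dy f = 0 → dz f = 0 → ∃ c, f = algebraMap K R c)
    {x y : R} (hxx : dx x = 1) (hyx : dy x = 0) (hyxy : dx y = 0) (hyy : dy y = 1)
    (hmem : ∀ f, dz f = 0 → f ∈ Algebra.adjoin K {x, y}) (huz : dz (dz u) = 0) :
    ∃ k l : K, (k ≠ 0 ∨ l ≠ 0) ∧ dz u = algebraMap K R k ∧ dz v = algebraMap K R l := by
  have : CharZero R := charZero_of_injective_algebraMap (FaithfulSMul.algebraMap_injective K R)
  have hh : ¬ (dx h = 0 ∧ dy h = 0) := fun ⟨h1, h2⟩ => by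
    obtain ⟨c, hc⟩ := hc h h1 h2 S.hz
    simpa using hI 0 0 1 c (by simp [hc])
  have t1 : dx (dz u) + dy (dz v) = 0 := by
    have := congrArg dz S.trace
    simpa only [map_add, map_zero, S.comm_zx, S.comm_zy] using this
  have t2 : dx (dz u) * dy (dz v) = dy (dz u) * dx (dz v) := by
    -- The second z-derivative is twice v_zy² + u_zy v_zx; the trace turns it into the planar
    -- determinant.
    have := congrArg dz (congrArg dz S.minors)
    have h2 : dz 2 = 0 := mod_cast dz.map_natCast 2
    simp only [map_add, map_zero, Derivation.leibniz, Derivation.leibniz_pow, smul_eq_mul,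
      nsmul_eq_mul, S.comm_zx, S.comm_zy, S.vzz, S.hz, huz, Nat.cast_ofNat, h2] at this
    apply mul_left_cancel₀ (two_ne_zero (α := R))
    linear_combination 2 * dy (dz v) * t1 - this
  obtain ⟨s, r, hsr, c, hrel⟩ := exists_linear_relation_of_nilpotent_plane (FractionRing R) hc
    S.comm_xy hxx hyx hyxy hyy huz S.vzz (hmem _ S.vzz) t1 t2
  obtain ⟨s', r', hdet⟩ := exists_unimodular_completion hsr
  have S' := S.linear_change huz hdet
  have hu' : dz (s • u + r • v) = algebraMap K R c := by simpa using hrel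
  have hcon : ∀ f, (r' • dx - s' • dy) f = 0 → (s • dy - r • dx) f = 0 → dx f = 0 ∧ dy f = 0 := by
    intro f h1 h2
    simp only [Derivation.sub_apply, Derivation.smul_apply] at h1 h2
    constructor
    · calc dx f = (s * r' - r * s') • dx f := by rw [hdet, one_smul]
        _ = s • (r' • dx f - s' • dy f) + s' • (s • dy f - r • dx f) := by module
        _ = 0 := by rw [h1, h2]; simp
    · calc dy f = (s * r' - r * s') • dy f := by rw [hdet, one_smul]
        _ = r • (r' • dx f - s' • dy f) + r' • (s • dy f - r • dx f) := by module
        _ = 0 := by rw [h1, h2]; simp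
  have hv' := S'.dz_constant_of_dz_fst_constant (by
      rintro ⟨h1, h2, h3⟩
      obtain ⟨h4, h5⟩ := hcon _ h1 h2
      obtain ⟨d, hd⟩ := hc _ h4 h5 h3
      obtain ⟨rfl, rfl, -⟩ := hI s r 0 d (by rw [zero_smul, add_zero, hd])
      simp at hsr)
    (fun h1 => hh (hcon _ h1.1 h1.2)) (by rw [hu']; simp) (by rw [hu']; simp) (by rw [hu']; simp)
  obtain ⟨h4, h5⟩ := hcon _ hv'.1 hv'.2
  obtain ⟨d, hd⟩ := hc _ h4 h5 S'.vzz
  simp only [map_add, Derivation.map_smul] at hd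
  have hku : dz u = algebraMap K R (r' * c - r * d) := by
    calc dz u = (s * r' - r * s') • dz u := by rw [hdet, one_smul]
      _ = r' • (s • dz u + r • dz v) - r • (s' • dz u + r' • dz v) := by module
      _ = _ := by rw [hrel, hd]; simp [Algebra.smul_def]
  have hkv : dz v = algebraMap K R (s * d - s' * c) := by
    calc dz v = (s * r' - r * s') • dz v := by rw [hdet, one_smul]
      _ = s • (s' • dz u + r' • dz v) - s' • (s • dz u + r • dz v) := by module
      _ = _ := by rw [hrel, hd]; simp [Algebra.smul_def]
  refine ⟨_, _, ?_, hku, hkv⟩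
  by_contra! hkl
  rw [hkl.1, map_zero] at hku
  rw [hkl.2, map_zero] at hkv
  have h2 := S.minors
  rw [hku, hkv] at h2
  obtain ⟨s, r, hsr, c, hrel⟩ := exists_linear_relation_of_nilpotent_plane (FractionRing R) hc
    S.comm_xy hxx hyx hyxy hyy hku hkv (hmem _ hkv) S.trace
    (by linear_combination dy v * S.trace - h2)
  obtain ⟨rfl, rfl, -⟩ := hI s r 0 c (by rw [zero_smul, add_zero, hrel])
  simp at hsr

/-- The classification when `u` is `z` plus a polynomial in `x`, `y` and `v` depends on
`x`, `y` only. -/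
theorem exists_normal_form [IsIntegrallyClosed R] (S : NilpotentTriple dx dy dz u v h)
    (hc : ∀ f, dx f = 0 → dy f = 0 → dz f = 0 → ∃ c, f = algebraMap K R c)
    {x y z : R} (hxx : dx x = 1) (hyx : dy x = 0) (hyxy : dx y = 0) (hyy : dy y = 1)
    (hzx : dx z = 0) (hzy : dy z = 0) (hzz : dz z = 1) (hyz : dz y = 0)
    (hmem : ∀ f, dz f = 0 → f ∈ Algebra.adjoin K {x, y})
    (huz : dz u = 1) (hvz : dz v = 0) (hv : ¬ (dx v = 0 ∧ dy v = 0)) :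
    ∃ (k b e c d : K) (g : Polynomial K),
      v = Polynomial.aeval (x + (k / 2) • y ^ 2 - b • y) g ∧
      u = z + e • y - (k • y - algebraMap K R b) * v + algebraMap K R c ∧
      h = (k / 2) • v ^ 2 - e • v + algebraMap K R d := by
  have h2 := S.minors
  have h3 := S.det
  rw [huz, hvz] at h2 h3
  have h2' : dy v ^ 2 + dy u * dx v + dx h = 0 := by linear_combination h2
  have h3' : dy h * dx v = dx h * dy v := by linear_combination h3
  have hvx : dx v ≠ 0 := by
    intro hvx
    have hvy : dy v ≠ 0 := fun hvy => hv ⟨hvx, hvy⟩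
    rw [hvx] at h2' h3'
    have : dy v ^ 3 = 0 := by linear_combination dy v * h2' + h3'
    exact hvy (by simpa using this)
  obtain ⟨k, b, hkb⟩ := exists_level_curve_parabola (FractionRing R) hc S.comm_xy hxx hyx hyxy hyy
    (hmem v hvz) hvx S.trace h2' h3'
  obtain ⟨g, hg⟩ := exists_aeval_eq_of_parabola hxx hyx hyxy hyy (hmem v hvz) k b hkb
  set w := k • y - algebraMap K R b with hw
  have hwx : dx w = 0 := by simp [hw, hyxy]
  have hwy : dy w = algebraMap K R k := by simp [hw, hyy, Algebra.smul_def]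
  have hwz : dz w = 0 := by simp [hw, hyz]
  -- With w = v_y/v_x, the combination f = u + w v absorbs the trace equation. It turns out that ∇h
  -- = (k v - f_y) ∇v, and the cross relation then forces f_yy = 0.
  have hfx : dx (u + w * v) = 0 := by
    simp only [map_add, Derivation.leibniz, hwx, smul_eq_mul]
    linear_combination S.trace - hkb
  have hfz : dz (u + w * v) = 1 := by simp [hwz, huz, hvz]
  have hfy : dy (u + w * v) = dy u + algebraMap K R k * v + w * dy v := by
    simp only [map_add, Derivation.leibniz, hwy, smul_eq_mul]; ring
  have hhx : dx h = (algebraMap K R k * v - dy (u + w * v)) * dx v := by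
    rw [hfy]; linear_combination h2' - dy v * hkb
  have hhy : dy h = (algebraMap K R k * v - dy (u + w * v)) * dy v := by
    apply mul_right_cancel₀ hvx
    rw [h3', hhx]; ring
  have hcross := Derivation.cross_mul_eq_of_smul dx dy (S.comm_xy h) (S.comm_xy v) hhx hhy
  have hex : dx (dy (u + w * v)) = 0 := by rw [S.comm_xy, hfx, map_zero]
  have hez : dz (dy (u + w * v)) = 0 := by rw [S.comm_zy, hfz, Derivation.map_one_eq_zero]
  have hey : dy (dy (u + w * v)) = 0 := by
    simp only [map_sub, Derivation.leibniz, hex, smul_eq_mul, Derivation.map_algebraMap] at hcross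
    refine (mul_eq_zero.1 ?_).resolve_right hvx
    linear_combination -hcross
  obtain ⟨e, he⟩ := hc _ hex hey hez
  obtain ⟨c, hc1⟩ := hc (u + w * v - z - e • y)
    (by rw [map_sub, map_sub, hfx]; simp [hzx, hyxy])
    (by rw [map_sub, map_sub, he]; simp [hzy, hyy, Algebra.smul_def])
    (by rw [map_sub, map_sub, hfz]; simp [hzz, hyz])
  have hk2 : algebraMap K R (k / 2) * 2 = algebraMap K R k := by
    rw [← map_ofNat (algebraMap K R) 2, ← map_mul]; congr 1; field_simp
  obtain ⟨d, hd⟩ := hc (h - (k / 2) • v ^ 2 + e • v)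
    (by
      rw [he] at hhx
      simp only [map_add, map_sub, Derivation.map_smul, Derivation.leibniz_pow, smul_eq_mul,
        nsmul_eq_mul, hhx]
      simp only [Algebra.smul_def]
      push_cast
      linear_combination -(v * dx v) * hk2)
    (by
      rw [he] at hhy
      simp only [map_add, map_sub, Derivation.map_smul, Derivation.leibniz_pow, smul_eq_mul,
        nsmul_eq_mul, hhy]
      simp only [Algebra.smul_def]
      push_cast
      linear_combination -(v * dy v) * hk2)
    (by simp [S.hz, hvz])
  exact ⟨k, b, e, c, d, g, hg, by linear_combination hc1, by linear_combination hd⟩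

end Classification

end NilpotentTriple

/-! ### From polynomial maps to the equations. -/

/-- The coefficients of the characteristic polynomial of a nilpotent `3 × 3` matrix vanish. -/
theorem Matrix.nilpotent_fin_three {R : Type*} [CommRing R] [IsDomain R] [CharZero R]
    {M : Matrix (Fin 3) (Fin 3) R} (h : IsNilpotent M) :
    M.trace = 0 ∧ (M * M).trace = 0 ∧ M.det = 0 := by
  refine ⟨?_, ?_, ?_⟩
  · exact (Matrix.isNilpotent_trace_of_isNilpotent h).eq_zero
  · exact (Matrix.isNilpotent_trace_of_isNilpotent ((Commute.refl M).isNilpotent_mul_left h)).eq_zero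
  · obtain ⟨n, hn⟩ := h
    have := congrArg Matrix.det hn
    rw [Matrix.det_pow, Matrix.det_zero] at this
    exact eq_zero_of_pow_eq_zero this

section Main

variable {K : Type*} [Field K] [CharZero K]

theorem PolyMap.nilpotentTriple (H : PolyMap 3 K)
    (hh : pderiv 2 (H 2) = 0) (hv : pderiv 2 (pderiv 2 (H 1)) = 0)
    (h_nil : IsNilpotent (PolyMap.jacobian H)) :
    NilpotentTriple (pderiv 0) (pderiv 1) (pderiv 2) (H 0) (H 1) (H 2) := by
  obtain ⟨h1, h2, h3⟩ := Matrix.nilpotent_fin_three h_nil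
  simp only [Matrix.trace_fin_three, Matrix.mul_apply, Fin.sum_univ_three, Matrix.det_fin_three,
    PolyMap.jacobian, Matrix.of_apply, hh] at h1 h2 h3
  refine ⟨pderiv_pderiv_comm _ _, pderiv_pderiv_comm _ _, pderiv_pderiv_comm _ _, hh, hv,
    by linear_combination h1, ?_, ?_⟩
  -- The trace of the squared Jacobian is twice the required expression once u_x² is replaced by
  -- v_y².
  · apply mul_left_cancel₀ (two_ne_zero (α := MvPolynomial (Fin 3) K))
    linear_combination h2 - (pderiv 0 (H 0) - pderiv 1 (H 1)) * h1
  · linear_combination h3 + pderiv 2 (H 1) * pderiv 1 (H 2) * h1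

omit [CharZero K] in
theorem PolyMap.comp_assoc {n : ℕ} (F G H : PolyMap n K) :
    (F.comp G).comp H = F.comp (G.comp H) := by
  funext i
  simp only [PolyMap.comp, bind₁_bind₁]
  rfl

omit [CharZero K] in
theorem PolyMap.ofMatrix_comp_ofMatrix {n : ℕ} (A B : Matrix (Fin n) (Fin n) K) :
    (PolyMap.ofMatrix A).comp (PolyMap.ofMatrix B) = PolyMap.ofMatrix (A * B) := by
  funext i
  simp only [PolyMap.comp, PolyMap.ofMatrix, map_sum, map_mul, bind₁_C_right, bind₁_X_right,
    Matrix.mul_apply, Finset.mul_sum, Finset.sum_mul]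
  rw [Finset.sum_comm]
  simp only [mul_assoc]

omit [CharZero K] in
theorem PolyMap.ofMatrix_one {n : ℕ} : PolyMap.ofMatrix (1 : Matrix (Fin n) (Fin n) K) = X := by
  funext i
  simp [PolyMap.ofMatrix, Matrix.one_apply]

omit [CharZero K] in
/-- If `A ∘ H = F ∘ A` for an invertible matrix `A`, then `F` is the conjugate of `H` by `A⁻¹`. -/
theorem PolyMap.conj_inv_eq {n : ℕ} (A : Matrix.GeneralLinearGroup (Fin n) K) (H F : PolyMap n K)
    (h : (PolyMap.ofMatrix A.val).comp H = F.comp (PolyMap.ofMatrix A.val)) :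
    PolyMap.conj A⁻¹ H = F := by
  rw [PolyMap.conj, inv_inv, ← PolyMap.comp_assoc, h, PolyMap.comp_assoc,
    PolyMap.ofMatrix_comp_ofMatrix, ← Units.val_mul, mul_inv_cancel, Units.val_one,
    PolyMap.ofMatrix_one]
  funext i
  simp [PolyMap.comp]

-- Evaluation at the origin kills the constant, so linear independence suffices.
omit [CharZero K] in
theorem PolyMap.independentModConstants (H : PolyMap 3 K)
    (h_zero : ∀ i, eval 0 (H i) = 0) (h_indep : LinearIndependent K H) :
    NilpotentTriple.IndependentModConstants K (H 0) (H 1) (H 2) := by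
  intro a b c d h
  have hd : d = 0 := by
    have := congrArg (eval 0) h
    rw [map_add, map_add, smul_eval, smul_eval, smul_eval, h_zero, h_zero, h_zero, algebraMap_eq,
      eval_C] at this
    simpa using this.symm
  rw [hd, map_zero] at h
  have := Fintype.linearIndependent_iff.1 h_indep ![a, b, c] (by simpa [Fin.sum_univ_three] using h)
  exact ⟨this 0, this 1, this 2⟩

/-- The first component has degree at most one in the third variable. -/
theorem PolyMap.degree_third_le_one (H : PolyMap 3 K)
    (S : NilpotentTriple (pderiv 0) (pderiv 1) (pderiv 2) (H 0) (H 1) (H 2))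
    (hI : NilpotentTriple.IndependentModConstants K (H 0) (H 1) (H 2))
    (hc : ∀ f : MvPolynomial (Fin 3) K, pderiv 0 f = 0 → pderiv 1 f = 0 → pderiv 2 f = 0 →
      ∃ c, f = algebraMap K _ c) :
    pderiv 2 (pderiv 2 (H 0)) = 0 := by
  classical
  by_contra hne
  let a : ℕ → MvPolynomial (Fin 3) K := fun k => (pderiv 2)^[k] (H 0)
  have ha : ∀ k, pderiv 2 (a k) = a (k + 1) := fun k => (Function.iterate_succ_apply' _ _ _).symm
  have hex : ∃ n, a n = 0 := ⟨_, pderiv_iterate_eq_zero (H 0) (Nat.lt_succ_self _)⟩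
  have hzero : ∀ k, a k = 0 → ∀ j, a (k + j) = 0 := fun k hk j => by
    induction j with
    | zero => exact hk
    | succ j ih => rw [← add_assoc, ← ha, ih, map_zero]
  have hn : 3 ≤ Nat.find hex := by
    by_contra! hlt
    refine hne ?_
    have := hzero _ (Nat.find_spec hex) (2 - Nat.find hex)
    rw [show Nat.find hex + (2 - Nat.find hex) = 2 by omega] at this
    exact this
  -- The z-degree of the first component is m + 2.
  obtain ⟨m, hm⟩ : ∃ m, Nat.find hex = m + 3 := ⟨Nat.find hex - 3, by omega⟩
  have hm1 : a (m + 2) ≠ 0 := Nat.find_min hex (by omega)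
  have hm2 : a (m + 3) = 0 := hm ▸ Nat.find_spec hex
  have hh : ¬ (pderiv 0 (H 2) = 0 ∧ pderiv 1 (H 2) = 0) := fun ⟨h1, h2⟩ => by
    obtain ⟨c, hc⟩ := hc _ h1 h2 S.hz
    simpa using hI 0 0 1 c (by simp [hc])
  have hv : ¬ (pderiv 0 (H 1) = 0 ∧ pderiv 1 (H 1) = 0 ∧ pderiv 2 (H 1) = 0) :=
    fun ⟨h1, h2, h3⟩ => by
      obtain ⟨c, hc⟩ := hc _ h1 h2 h3
      simpa using hI 0 1 0 c (by simp [hc])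
  have S' : NilpotentTriple (pderiv 0) (pderiv 1) (pderiv 2) (a 0) (H 1) (H 2) := S
  refine S'.leading_not_constant ha hv hh hc (fun b c h => ?_) hm1 hm2
    (S'.dy_leading_eq_zero ha hv hh ?_ hm1 hm2)
  · simpa using hI 0 (-b) 1 c (by rw [h]; simp)
  · intro p q n hn hp hpx hpz hqx hqz hqy hrel
    refine not_dvd_of_mul_pderiv_eq hn hp (fun j hj => ?_) (fun j hj => ?_) hqy hrel
    · fin_cases j
      · exact hpx
      · exact absurd rfl hj
      · exact hpz
    · fin_cases j
      · exact hqx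
      · exact absurd rfl hj
      · exact hqz

end Main

/-! ### Assembling the conjugation. -/

theorem theorem2p5 {K : Type*} [Field K] [CharZero K] (H : PolyMap 3 K)
    (hz_h : degreeOf 2 (H 2) = 0) (hz_v : degreeOf 2 (H 1) ≤ 1)
    (h_zero : ∀ i, eval 0 (H i) = 0) (h_indep : LinearIndependent K H)
    (h_nil : IsNilpotent (PolyMap.jacobian H)) :
    ∃ (T : Matrix.GeneralLinearGroup (Fin 3) K) (g : Polynomial K),
      g ≠ 0 ∧ g.eval 0 = 0 ∧ PolyMap.conj T H = PolyMap.standardForm g := by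
  have S := PolyMap.nilpotentTriple H (pderiv_eq_zero_of_degreeOf hz_h)
    (pderiv_iterate_eq_zero (n := 2) (H 1) (by omega)) h_nil
  have hI := PolyMap.independentModConstants H h_zero h_indep
  have hc : ∀ f : MvPolynomial (Fin 3) K, pderiv 0 f = 0 → pderiv 1 f = 0 → pderiv 2 f = 0 →
      ∃ c, f = algebraMap K _ c := fun f h0 h1 h2 =>
    ⟨_, eq_C_of_pderiv_eq_zero fun i => by fin_cases i <;> assumption⟩
  have huz := PolyMap.degree_third_le_one H S hI hc
  have p00 : pderiv 0 (X 0 : MvPolynomial (Fin 3) K) = 1 := pderiv_X_self 0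
  have p11 : pderiv 1 (X 1 : MvPolynomial (Fin 3) K) = 1 := pderiv_X_self 1
  have p22 : pderiv 2 (X 2 : MvPolynomial (Fin 3) K) = 1 := pderiv_X_self 2
  have p01 : pderiv 0 (X 1 : MvPolynomial (Fin 3) K) = 0 := pderiv_X_of_ne (by decide)
  have p02 : pderiv 0 (X 2 : MvPolynomial (Fin 3) K) = 0 := pderiv_X_of_ne (by decide)
  have p10 : pderiv 1 (X 0 : MvPolynomial (Fin 3) K) = 0 := pderiv_X_of_ne (by decide)
  have p12 : pderiv 1 (X 2 : MvPolynomial (Fin 3) K) = 0 := pderiv_X_of_ne (by decide)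
  have p20 : pderiv 2 (X 0 : MvPolynomial (Fin 3) K) = 0 := pderiv_X_of_ne (by decide)
  have p21 : pderiv 2 (X 1 : MvPolynomial (Fin 3) K) = 0 := pderiv_X_of_ne (by decide)
  obtain ⟨l, m, hlm, hul, hvm⟩ := S.exists_dz_constant hI hc p00 p10 p01 p11
    (fun f hf => mem_adjoin_of_pderiv_two_eq_zero hf) huz
  -- The rows (s, r) and (-m, l) have determinant 1 and turn (u_z, v_z) = (l, m) into (1, 0).
  obtain ⟨s, r, hsr⟩ : ∃ s r : K, s * l + r * m = 1 := by
    rcases hlm with h | h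
    · exact ⟨l⁻¹, 0, by field_simp; simp⟩
    · exact ⟨0, m⁻¹, by field_simp; simp⟩
  have hdet : s * l - r * (-m) = 1 := by linear_combination hsr
  have S' := S.linear_change huz hdet
  set x : MvPolynomial (Fin 3) K := s • X 0 + r • X 1 with hx
  set y : MvPolynomial (Fin 3) K := (-m) • X 0 + l • X 1 with hy
  set u := s • H 0 + r • H 1 with hu
  set v := (-m) • H 0 + l • H 1 with hv
  have hone : (s * l + r * m) • (1 : MvPolynomial (Fin 3) K) = 1 := by rw [hsr, one_smul]
  have hmem : ∀ f : MvPolynomial (Fin 3) K, pderiv 2 f = 0 → f ∈ Algebra.adjoin K {x, y} := by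
    intro f hf
    refine Algebra.adjoin_le ?_ (mem_adjoin_of_pderiv_two_eq_zero hf)
    have h1 : x ∈ Algebra.adjoin K {x, y} := Algebra.subset_adjoin (by simp)
    have h2 : y ∈ Algebra.adjoin K {x, y} := Algebra.subset_adjoin (by simp)
    rintro _ (rfl | rfl)
    · have h3 := Subalgebra.sub_mem _ (Subalgebra.smul_mem _ h1 l) (Subalgebra.smul_mem _ h2 r)
      have : l • x - r • y = (s * l - r * (-m)) • X 0 := by rw [hx, hy]; module
      rwa [this, hdet, one_smul] at h3
    · have h3 := Subalgebra.add_mem _ (Subalgebra.smul_mem _ h1 m) (Subalgebra.smul_mem _ h2 s)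
      have : m • x + s • y = (s * l - r * (-m)) • X 1 := by rw [hx, hy]; module
      rwa [this, hdet, one_smul] at h3
  have hc' : ∀ f, (l • pderiv 0 - (-m) • pderiv 1 :
        Derivation K (MvPolynomial (Fin 3) K) (MvPolynomial (Fin 3) K)) f = 0 →
      (s • pderiv 1 - r • pderiv 0 :
        Derivation K (MvPolynomial (Fin 3) K) (MvPolynomial (Fin 3) K)) f = 0 →
      pderiv 2 f = 0 → ∃ c, f = algebraMap K (MvPolynomial (Fin 3) K) c := by
    intro f h1 h2 h3
    simp only [Derivation.sub_apply, Derivation.smul_apply] at h1 h2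
    refine hc f ?_ ?_ h3
    · calc pderiv 0 f = (s * l - r * (-m)) • pderiv 0 f := by rw [hdet, one_smul]
        _ = s • (l • pderiv 0 f - (-m) • pderiv 1 f) +
            (-m) • (s • pderiv 1 f - r • pderiv 0 f) := by module
        _ = 0 := by rw [h1, h2]; simp
    · calc pderiv 1 f = (s * l - r * (-m)) • pderiv 1 f := by rw [hdet, one_smul]
        _ = r • (l • pderiv 0 f - (-m) • pderiv 1 f) +
            l • (s • pderiv 1 f - r • pderiv 0 f) := by module
        _ = 0 := by rw [h1, h2]; simp
  have hvc : ∀ c, v ≠ algebraMap K _ c := fun c hvc => by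
    obtain ⟨h1, h2, -⟩ := hI (-m) l 0 c (by rw [← hvc, hv, zero_smul, add_zero])
    rcases hlm with h | h
    · exact h h2
    · exact h (neg_eq_zero.1 h1)
  have hvz : pderiv 2 v = 0 := by
    rw [hv, map_add, Derivation.map_smul, Derivation.map_smul, hul, hvm, Algebra.smul_def,
      Algebra.smul_def, ← map_mul, ← map_mul, ← map_add, ← map_zero (algebraMap K _)]
    congr 1; ring
  obtain ⟨k, b, e, c, d, g, hg, hu', hh'⟩ := S'.exists_normal_form (x := x) (y := y) (z := X 2) hc'
    (by
      simp only [hx, Derivation.sub_apply, Derivation.smul_apply, map_add, Derivation.map_smul,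
        p00, p01, p10, p11, smul_zero]
      refine Eq.trans ?_ hone
      module)
    (by
      simp only [hx, Derivation.sub_apply, Derivation.smul_apply, map_add, Derivation.map_smul,
        p00, p01, p10, p11, smul_zero]
      module)
    (by
      simp only [hy, Derivation.sub_apply, Derivation.smul_apply, map_add, Derivation.map_smul,
        p00, p01, p10, p11, smul_zero]
      module)
    (by
      simp only [hy, Derivation.sub_apply, Derivation.smul_apply, map_add, Derivation.map_smul,
        p00, p01, p10, p11, smul_zero]
      refine Eq.trans ?_ hone
      module)
    (by simp [p02, p12]) (by simp [p02, p12]) p22 (by simp [hy, p20, p21]) hmem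
    (by
      rw [hu, map_add, Derivation.map_smul, Derivation.map_smul, hul, hvm, Algebra.smul_def,
        Algebra.smul_def, ← map_mul, ← map_mul, ← map_add, hsr, map_one])
    hvz
    (fun ⟨h1, h2⟩ => by
      obtain ⟨c, h⟩ := hc' v h1 h2 hvz
      exact hvc c h)
  have hx0 : eval 0 x = 0 := by simp [hx]
  have hy0 : eval 0 y = 0 := by simp [hy]
  have hu0 : eval 0 u = 0 := by rw [hu, map_add, smul_eval, smul_eval, h_zero, h_zero]; simp
  have hv0 : eval 0 v = 0 := by rw [hv, map_add, smul_eval, smul_eval, h_zero, h_zero]; simp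
  obtain rfl : c = 0 := by
    have := congrArg (eval 0) hu'
    simp only [map_add, map_sub, map_mul, hu0, hv0, smul_eval, hy0, eval_X, algebraMap_eq,
      eval_C] at this
    simpa using this.symm
  obtain rfl : d = 0 := by
    have := congrArg (eval 0) hh'
    simp only [map_add, map_sub, map_pow, h_zero, hv0, smul_eval, algebraMap_eq, eval_C] at this
    simpa using this.symm
  have hg0 : g.eval 0 = 0 := by
    have hev : ∀ p, aeval (0 : Fin 3 → K) p = eval 0 p := fun p =>
      DFunLike.congr_fun (coe_aeval_eq_eval 0) p
    have := congrArg (aeval (0 : Fin 3 → K)) hg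
    rw [← Polynomial.aeval_algHom_apply] at this
    simp only [map_add, map_sub, hev, smul_eval, map_pow, hx0, hy0, hv0] at this
    simpa [Polynomial.aeval_def, Polynomial.eval₂_eq_eval_map] using this.symm
  -- For k = 0 the third component would be -e v, against independence.
  have hk : k ≠ 0 := by
    rintro rfl
    have := hI (e * (-m)) (e * l) 1 0 (by
      rw [hh', hv]; simp only [zero_div, zero_smul, map_zero]; module)
    exact one_ne_zero this.2.2
  rw [map_zero, add_zero] at hu' hh'
  -- The rows are the new coordinates (2/k)(x - b y), y and (2/k)(z + e y): they absorb b and e and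
  -- normalize the coefficient k/2 to 1.
  let A : Matrix (Fin 3) (Fin 3) K :=
    !![2 / k * (s + b * m), 2 / k * (r - b * l), 0; -m, l, 0; -(2 / k * (e * m)), 2 / k * (e * l),
      2 / k]
  have hA : A.det ≠ 0 := by
    have : A.det = (2 / k) ^ 2 := by
      simp only [A, Matrix.det_fin_three, Matrix.of_apply, Matrix.cons_val]
      linear_combination (2 / k) ^ 2 * hsr
    rw [this]
    exact pow_ne_zero 2 (div_ne_zero two_ne_zero hk)
  have a0 : PolyMap.ofMatrix A 0 = (2 / k) • (x - b • y) := by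
    simp only [PolyMap.ofMatrix, Fin.sum_univ_three, A, Matrix.of_apply, Matrix.cons_val,
      ← smul_eq_C_mul, hx, hy]
    module
  have a1 : PolyMap.ofMatrix A 1 = y := by
    simp only [PolyMap.ofMatrix, Fin.sum_univ_three, A, Matrix.of_apply, Matrix.cons_val,
      ← smul_eq_C_mul, hy]
    module
  have a2 : PolyMap.ofMatrix A 2 = (2 / k) • (X 2 + e • y) := by
    simp only [PolyMap.ofMatrix, Fin.sum_univ_three, A, Matrix.of_apply, Matrix.cons_val,
      ← smul_eq_C_mul, hy]
    module
  have b0 : (PolyMap.ofMatrix A).comp H 0 = (2 / k) • (u - b • v) := by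
    simp only [PolyMap.comp, PolyMap.ofMatrix, Fin.sum_univ_three, A, Matrix.of_apply,
      Matrix.cons_val, ← smul_eq_C_mul, hu, hv, map_add, map_smul, bind₁_X_right]
    module
  have b1 : (PolyMap.ofMatrix A).comp H 1 = v := by
    simp only [PolyMap.comp, PolyMap.ofMatrix, Fin.sum_univ_three, A, Matrix.of_apply,
      Matrix.cons_val, ← smul_eq_C_mul, hv, map_add, map_smul, bind₁_X_right]
    module
  have b2 : (PolyMap.ofMatrix A).comp H 2 = (2 / k) • (H 2 + e • v) := by
    simp only [PolyMap.comp, PolyMap.ofMatrix, Fin.sum_univ_three, A, Matrix.of_apply,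
      Matrix.cons_val, ← smul_eq_C_mul, hv, map_add, map_smul, bind₁_X_right]
    module
  have hkk : C (2 / k) * C k = (2 : MvPolynomial (Fin 3) K) := by
    rw [← C_mul, div_mul_cancel₀ _ hk]; rfl
  have hkk' : C (2 / k) * C (k / 2) = (1 : MvPolynomial (Fin 3) K) := by
    rw [← C_mul, ← C_1]; congr 1; field_simp
  -- The argument x + (k/2) y² - b y of g is k/2 times the new x + y².
  let g₁ := g.comp (Polynomial.C (k / 2) * Polynomial.X)
  have hg₁ : Polynomial.aeval (PolyMap.ofMatrix A 0 + PolyMap.ofMatrix A 1 ^ 2) g₁ = v := by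
    rw [hg, Polynomial.aeval_comp, a0, a1]
    congr 2
    simp only [map_mul, Polynomial.aeval_C, Polynomial.aeval_X, algebraMap_eq, smul_eq_C_mul]
    linear_combination (x - C b * y) * hkk'
  have hbind : bind₁ (PolyMap.ofMatrix A) (Polynomial.aeval (X 0 + X 1 ^ 2) g₁) = v := by
    rw [← Polynomial.aeval_algHom_apply, map_add, map_pow, bind₁_X_right, bind₁_X_right, hg₁]
  refine ⟨(Matrix.GeneralLinearGroup.mkOfDetNeZero A hA)⁻¹, g₁, ?_, ?_, ?_⟩
  · intro h0
    rw [h0, map_zero] at hg₁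
    exact hvc 0 (by rw [← hg₁, map_zero])
  · simpa [g₁] using hg0
  · refine PolyMap.conj_inv_eq _ _ _ ?_
    change (PolyMap.ofMatrix A).comp H = (PolyMap.standardForm g₁).comp (PolyMap.ofMatrix A)
    funext i
    fin_cases i
    · change (PolyMap.ofMatrix A).comp H 0 = bind₁ (PolyMap.ofMatrix A) (X 2 - 2 * X 1 *
        Polynomial.aeval (X 0 + X 1 ^ 2 : MvPolynomial (Fin 3) K) g₁)
      rw [map_sub, map_mul, map_mul, hbind, bind₁_X_right, bind₁_X_right, map_ofNat, a1, a2, b0,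
        hu']
      simp only [smul_eq_C_mul, algebraMap_eq]
      linear_combination -(y * v) * hkk
    · change (PolyMap.ofMatrix A).comp H 1 = bind₁ (PolyMap.ofMatrix A)
        (Polynomial.aeval (X 0 + X 1 ^ 2 : MvPolynomial (Fin 3) K) g₁)
      rw [hbind, b1]
    · change (PolyMap.ofMatrix A).comp H 2 = bind₁ (PolyMap.ofMatrix A)
        (Polynomial.aeval (X 0 + X 1 ^ 2 : MvPolynomial (Fin 3) K) g₁ ^ 2)
      rw [map_pow, hbind, b2, hh']
      simp only [smul_eq_C_mul]
      linear_combination v ^ 2 * hkk'
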